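/- For $\Re(\omega_1),\Re(\omega_2)>0$ and $0<\Re(z)<\Re(\omega_1+\omega_2)$ set \[F(z\,|\,\omega_1,\omega_2)=\exp\bigg(\int_C \frac{e^{zs}}{(e^{\omega_1 s}-1)(e^{\omega_2 s}-1)}\frac{ds}{s}\bigg),\qquad G(z\,|\,\omega_1,\omega_2)=\exp\bigg(\int_C \frac{-e^{(z+\omega_1)s}}{(e^{\omega_1 s}-1)^2(e^{\omega_2 s}-1)}\frac{ds}{s}\bigg),\] where the contour $C$ follows the real axis from $-\infty$ to $+\infty$, avoiding the origin by a small detour in the upper half-plane. The same symbols denote the (single-valued) meromorphic continuations of these functions to all $z\in\mathbb C$ and all $\omega_1,\omega_2\in\mathbb C^*$ with $\omega_1/\omega_2\notin\mathbb R_{<0}$; these are given by invariance under simultaneous rescaling of $(z,\omega_1,\omega_2)$ and by the difference equations $F(z+\omega_1\,|\,\omega_1,\omega_2)=F(z\,|\,\omega_1,\omega_2)\,(1-e^{2\pi i z/\omega_2})^{-1}$ and $G(z+\omega_1\,|\,\omega_1,\omega_2)=G(z\,|\,\omega_1,\omega_2)\,F(z+\omega_1\,|\,\omega_1,\omega_2)^{-1}$.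 Let $\operatorname{Li}_k(x)=\sum_{n\ge1}x^n/n^k$ for $|x|<1$, and let $M_+=\{(v,w)\in\mathbb C^2: w\ne0,\ \Im(v/w)>0\}$. For $(v,w)\in M_+$, $(\vartheta,\varphi)\in\mathbb C^2$ and $\hbar\in\mathbb C^*$ put \[F^*(v,w,\vartheta,\varphi,\hbar)=F(v-\hbar\vartheta\,|\,w-\hbar\varphi,-2\pi i\hbar)\cdot e^{Q_F},\qquad G^*(v,w,\vartheta,\varphi,\hbar)=G(v-\hbar\vartheta\,|\,w-\hbar\varphi,-2\pi i\hbar)\cdot e^{Q_G},\] where, with $x=e^{2\pi i v/w}$, \[Q_F=\frac1\hbar\cdot\frac{w-\hbar\varphi}{(2\pi i)^2}\operatorname{Li}_2(x)+\Big(\frac{v\varphi-w\vartheta}{2\pi i w}+\frac12\Big)\operatorname{Li}_1(x),\] \[Q_G=\frac2\hbar\cdot\frac{w-\hbar\varphi}{(2\pi i)^3}\operatorname{Li}_3(x)-\frac1\hbar\cdot\frac{v-\hbar\vartheta}{(2\pi i)^2}\operatorname{Li}_2(x)+\frac1{\pi i}\Big(\frac{v\varphi-w\vartheta}{2\pi i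 w}+\frac14\Big)\operatorname{Li}_2(x)-\frac vw\Big(\frac{v\varphi-w\vartheta}{2\pi i w}+\frac12\Big)\operatorname{Li}_1(x).\] Fix $(v,w)\in M_+$ with $0<\Re(v)<\Re(w)$, and $(\vartheta,\varphi)\in\mathbb C^2$. Then, as $\hbar\to0$ in the half-plane $\Im(\hbar)>0$, \[F^*(v,w,\vartheta,\varphi,\hbar)\to1,\qquad G^*(v,w,\vartheta,\varphi,\hbar)\to1.\] Moreover, if $(\vartheta,\varphi)$ is generic, in the sense that $\varphi/(2\pi i)\notin\mathbb R_{\le0}$ and $\vartheta\notin\mathbb Z\varphi+2\pi i\,\mathbb Z$, then both functions are bounded as $\hbar\to\infty$ in the half-plane $\Im(\hbar)>0$. -/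

import Mathlib

open Complex Filter Topology

noncomputable section

namespace Conifold

/-- The base `M_+ = {(v, w) : w ≠ 0, Im (v / w) > 0}`. -/
def Mplus : Set (ℂ × ℂ) := {p | p.2 ≠ 0 ∧ 0 < (p.1 / p.2).im}

/-- The integral of `f` along the contour which follows the real axis from `-∞` to `+∞`, except
that it avoids the origin along the half-circle of radius `ε` in the upper half-plane,
traversed from `-ε` to `ε`. -/
def contourIntegral (ε : ℝ) (f : ℂ → ℂ) : ℂ :=
  (∫ s in Set.Iic (-ε), f (s : ℂ))
    + (∫ t in Real.pi..0, f (ε * exp (t * I)) * (ε * exp (t * I) * I))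
    + (∫ s in Set.Ici ε, f (s : ℂ))

/-- A radius for the detour: smaller than the modulus of every non-zero point of
`(2πi / ω₁) ℤ` and of `(2πi / ω₂) ℤ`. -/
def detour (ω₁ ω₂ : ℂ) : ℝ := 1 / (‖ω₁‖ + ‖ω₂‖)

/-- The integral representation of `F (z | ω₁, ω₂)`, valid for `0 < Re ω₁`, `0 < Re ω₂` and
`0 < Re z < Re (ω₁ + ω₂)`. -/
def FInt (z ω₁ ω₂ : ℂ) : ℂ :=
  exp (contourIntegral (detour ω₁ ω₂) fun s =>
    exp (z * s) / ((exp (ω₁ * s) - 1) * (exp (ω₂ * s) - 1)) / s)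

/-- The integral representation of `G (z | ω₁, ω₂)`, valid for `0 < Re ω₁`, `0 < Re ω₂` and
`0 < Re z < Re (ω₁ + ω₂)`. -/
def GInt (z ω₁ ω₂ : ℂ) : ℂ :=
  exp (contourIntegral (detour ω₁ ω₂) fun s =>
    -exp ((z + ω₁) * s) / ((exp (ω₁ * s) - 1) ^ 2 * (exp (ω₂ * s) - 1)) / s)

/-- For `0 < Re ω₁` and `0 < Re ω₂`, an integer `n` such that `z - n ω₁` lies in the strip
`0 < Re < Re (ω₁ + ω₂)`; it is `0` if `z` itself lies there. -/
def shift (z ω₁ ω₂ : ℂ) : ℤ :=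
  if 0 < z.re ∧ z.re < (ω₁ + ω₂).re then 0 else ⌈z.re / ω₁.re⌉ - 1

/-- For `0 < Re ω₁` and `0 < Re ω₂`, the meromorphic continuation of `F (z | ω₁, ω₂)` to all
`z : ℂ`. It is given by the integral in the strip `0 < Re z < Re (ω₁ + ω₂)`, and outside by the
difference equation `F (z + ω₁ | ω₁, ω₂) = F (z | ω₁, ω₂) * (1 - exp (2πi z / ω₂))⁻¹`. -/
def FHalf (z ω₁ ω₂ : ℂ) : ℂ :=
  FInt (z - shift z ω₁ ω₂ * ω₁) ω₁ ω₂
    * (∏ k ∈ Finset.range (shift z ω₁ ω₂).toNat,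
        (1 - exp (2 * Real.pi * I * (z - (k + 1) * ω₁) / ω₂))⁻¹)
    * ∏ k ∈ Finset.range (-shift z ω₁ ω₂).toNat,
        (1 - exp (2 * Real.pi * I * (z + k * ω₁) / ω₂))

/-- For `0 < Re ω₁` and `0 < Re ω₂`, the holomorphic continuation of `G (z | ω₁, ω₂)` to all
`z : ℂ`. It is given by the integral in the strip `0 < Re z < Re (ω₁ + ω₂)`, and outside by the
difference equation `G (z + ω₁ | ω₁, ω₂) = G (z | ω₁, ω₂) * F (z + ω₁ | ω₁, ω₂)⁻¹`. -/
def GHalf (z ω₁ ω₂ : ℂ) : ℂ :=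
  GInt (z - shift z ω₁ ω₂ * ω₁) ω₁ ω₂
    * (∏ k ∈ Finset.range (shift z ω₁ ω₂).toNat, (FHalf (z - k * ω₁) ω₁ ω₂)⁻¹)
    * ∏ k ∈ Finset.range (-shift z ω₁ ω₂).toNat, FHalf (z + (k + 1) * ω₁) ω₁ ω₂

/-- A scaling factor: if `ω₁ / ω₂` does not lie in `ℝ_{≤ 0}`, then `scale ω₁ ω₂ * ω₁` and
`scale ω₁ ω₂ * ω₂` are the square roots of `ω₁ / ω₂` and of `ω₂ / ω₁` with positive real part. -/
def scale (ω₁ ω₂ : ℂ) : ℂ := (ω₁ / ω₂) ^ (1 / 2 : ℂ) / ω₁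

open Classical in
/-- The function `F (z | ω₁, ω₂)`, for `z : ℂ` and non-zero `ω₁, ω₂` whose ratio is not a negative
real number: the continuation of the integral from `0 < Re ω₁`, `0 < Re ω₂` by invariance under
simultaneous rescaling of the three variables. -/
def F (z ω₁ ω₂ : ℂ) : ℂ :=
  if 0 < ω₁.re ∧ 0 < ω₂.re then FHalf z ω₁ ω₂
  else FHalf (scale ω₁ ω₂ * z) (scale ω₁ ω₂ * ω₁) (scale ω₁ ω₂ * ω₂)

open Classical in
/-- The function `G (z | ω₁, ω₂)`, for `z : ℂ` and non-zero `ω₁, ω₂` whose ratio is not a negative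
real number: the continuation of the integral from `0 < Re ω₁`, `0 < Re ω₂` by invariance under
simultaneous rescaling of the three variables. -/
def G (z ω₁ ω₂ : ℂ) : ℂ :=
  if 0 < ω₁.re ∧ 0 < ω₂.re then GHalf z ω₁ ω₂
  else GHalf (scale ω₁ ω₂ * z) (scale ω₁ ω₂ * ω₁) (scale ω₁ ω₂ * ω₂)

/-- The polylogarithm `Li_k x = ∑_{n ≥ 1} x ^ n / n ^ k`, for `‖x‖ < 1`. -/
def Li (k : ℕ) (x : ℂ) : ℂ := ∑' n : ℕ, x ^ (n + 1) / ((n : ℂ) + 1) ^ k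

/-- The exponential factor `Q_F`. -/
def QF (v w ϑ φ ħ : ℂ) : ℂ :=
  1 / ħ * ((w - ħ * φ) / (2 * Real.pi * I) ^ 2) * Li 2 (exp (2 * Real.pi * I * v / w))
    + ((v * φ - w * ϑ) / (2 * Real.pi * I * w) + 1 / 2) * Li 1 (exp (2 * Real.pi * I * v / w))

/-- The exponential factor `Q_G`. -/
def QG (v w ϑ φ ħ : ℂ) : ℂ :=
  2 / ħ * ((w - ħ * φ) / (2 * Real.pi * I) ^ 3) * Li 3 (exp (2 * Real.pi * I * v / w))
    - 1 / ħ * ((v - ħ * ϑ) / (2 * Real.pi * I) ^ 2) * Li 2 (exp (2 * Real.pi * I * v / w))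
    + 1 / (Real.pi * I) * ((v * φ - w * ϑ) / (2 * Real.pi * I * w) + 1 / 4)
        * Li 2 (exp (2 * Real.pi * I * v / w))
    - v / w * ((v * φ - w * ϑ) / (2 * Real.pi * I * w) + 1 / 2)
        * Li 1 (exp (2 * Real.pi * I * v / w))

/-- The function `F^*`. -/
def Fstar (v w ϑ φ ħ : ℂ) : ℂ :=
  F (v - ħ * ϑ) (w - ħ * φ) (-2 * Real.pi * I * ħ) * exp (QF v w ϑ φ ħ)

/-- The function `G^*`. -/
def Gstar (v w ϑ φ ħ : ℂ) : ℂ :=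
  G (v - ħ * ϑ) (w - ħ * φ) (-2 * Real.pi * I * ħ) * exp (QG v w ϑ φ ħ)

/-- Genericity of `(ϑ, φ)`: the ratio `φ / 2πi` does not lie in `ℝ_{≤ 0}`, and `ϑ` does not lie in
`ℤ φ + 2πi ℤ`. -/
def IsGeneric (ϑ φ : ℂ) : Prop :=
  φ / (2 * Real.pi * I) ∈ slitPlane ∧ ∀ a b : ℤ, ϑ ≠ a * φ + b * (2 * Real.pi * I)

end Conifold

end

/-!
The contour of the integrals defining `F` and `G` is pushed up to a horizontal line `Im s = η`
below the first poles in the upper half-plane (`contourIntegral_eq_line`). There the integrand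
`e ^ (z s) / ((e ^ (ω₁ s) - 1) ^ p (e ^ (ω₂ s) - 1) ^ q s ^ k)` decays exponentially, locally
uniformly in the parameters (`Adm.exists_bound`), so that the integrals are continuous, can be
differentiated, and are invariant under simultaneous complex rescaling of `(z, ω₁, ω₂)` as long as
the periods stay in the right half-plane (`lineInt_smul_congr`). With a single period the integrals
are polylogarithms of `e ^ (2πi z / ω)` (`Adm.lineInt_eq_Li`); the case `k = 0` reduces to the
reflection formula of the Gamma function, and the others follow by integration in `z`. The case
`k = 1` also yields the difference equation of `F`.

As `ħ → 0`, the period `ω₂ = -2πi ħ` tends to `0` in the right half-plane, possibly tangentially to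
the imaginary axis. A small rotation of all variables, in a sense which depends on the sign of
`Re ħ`, brings `ω₂` into a closed sector around the positive real axis. There
`1 / (e ^ u - 1) = 1 / u - 1 / 2 + O(u)` holds uniformly along the line (`norm_toddRem_le`), and the
first two terms give polylogarithms. The exponents `Q_F` and `Q_G` cancel these terms after a
first-order expansion in `ħ` (`tendsto_QF_add_asympF`, `tendsto_QG_add_asympG`).

As `ħ → ∞`, rescaling turns the parameters into ones which converge to a multiple of
`(ϑ, φ, 2πi)`, with both periods in the open right half-plane. The continuations do not depend on
the shift into the strip (`FHalf_eq_of_inStrip`) and are invariant under rescaling (`FHalf_smul`),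
so that they can be computed near the limit by one fixed shift. They are continuous there, since
genericity keeps `ϑ` away from the zeros and poles, and `F*` and `G*` even converge.
-/

namespace Conifold

open MeasureTheory

/-! ### The integrand along a horizontal line -/

/-- The integrand common to `F` (`p = q = 1`), to `G` (`p = 2`, `q = 1`) and to the polylogarithms
(`p = 1`, `q = 0`). -/
noncomputable def kernel (p q k : ℕ) (z ω₁ ω₂ s : ℂ) : ℂ :=
  exp (z * s) * ((exp (ω₁ * s) - 1)⁻¹) ^ p * ((exp (ω₂ * s) - 1)⁻¹) ^ q * (s⁻¹) ^ k

/-- The integral of `kernel` along the horizontal line `Im s = η`. -/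
noncomputable def lineInt (p q k : ℕ) (η : ℝ) (z ω₁ ω₂ : ℂ) : ℂ :=
  ∫ t : ℝ, kernel p q k z ω₁ ω₂ (t + η * I)

/-- The conditions under which `kernel` decays exponentially in both directions along `Im s = η`
and has no pole in `0 < Im s ≤ η`: the zeros of `e ^ (ωᵢ s) - 1` off the real axis which are
closest to it are `±2πi / ωᵢ`. -/
structure Adm (p q : ℕ) (η : ℝ) (z ω₁ ω₂ : ℂ) : Prop where
  η_pos : 0 < η
  re₁ : 0 < ω₁.re
  re₂ : 0 < ω₂.re
  lt₁ : η * ‖ω₁‖ ^ 2 < 2 * Real.pi * ω₁.re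
  lt₂ : η * ‖ω₂‖ ^ 2 < 2 * Real.pi * ω₂.re
  z_pos : 0 < z.re
  z_lt : z.re < p * ω₁.re + q * ω₂.re

theorem norm_exp_mul_inv_le {e : ℂ} {c : ℝ} (hc : 0 ≤ c) (h : ‖(e - 1)⁻¹‖ ≤ c) :
    ‖e * (e - 1)⁻¹‖ ≤ 1 + c := by
  by_cases he : e - 1 = 0
  · simp [he]; linarith
  · have : e * (e - 1)⁻¹ = 1 + (e - 1)⁻¹ := by field_simp; ring
    rw [this]
    exact (norm_add_le _ _).trans (by simpa using h)

/-- Pointwise decay of the integrand: to the left it is governed by `e ^ (z s)`, to the right by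
`e ^ ((z - p ω₁ - q ω₂) s)`, after pairing each `1 / (e ^ (ωᵢ s) - 1)` with a factor `e ^ (ωᵢ s)`. -/
theorem norm_kernel_le {p q k : ℕ} {z ω₁ ω₂ s : ℂ} {c m δ M : ℝ} (hc : 0 ≤ c) (hm : 0 < m)
    (hs : m ≤ ‖s‖) (h₁ : ‖(exp (ω₁ * s) - 1)⁻¹‖ ≤ c) (h₂ : ‖(exp (ω₂ * s) - 1)⁻¹‖ ≤ c)
    (hδ₁ : δ ≤ z.re) (hδ₂ : δ ≤ p * ω₁.re + q * ω₂.re - z.re)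
    (hM₁ : ‖z‖ ≤ M) (hM₂ : ‖z - p * ω₁ - q * ω₂‖ ≤ M) :
    ‖kernel p q k z ω₁ ω₂ s‖ ≤
      (1 + c) ^ p * (1 + c) ^ q * m⁻¹ ^ k * Real.exp (M * |s.im|) * Real.exp (-δ * |s.re|) := by
  have key : ∀ (ζ : ℂ), ‖ζ‖ ≤ M → (ζ.re * s.re ≤ -δ * |s.re|) →
      ‖exp (ζ * s)‖ ≤ Real.exp (M * |s.im|) * Real.exp (-δ * |s.re|) := by
    intro ζ hζ h
    rw [norm_exp, ← Real.exp_add, Real.exp_le_exp, mul_re]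
    have h1 : -(ζ.im * s.im) ≤ M * |s.im| := by
      refine (neg_le_abs _).trans ?_
      rw [abs_mul]
      exact mul_le_mul_of_nonneg_right ((abs_im_le_norm ζ).trans hζ) (abs_nonneg _)
    linarith
  have hk : ‖(s⁻¹) ^ k‖ ≤ m⁻¹ ^ k := by
    rw [norm_pow, norm_inv]
    gcongr
  have hm' : 0 ≤ m⁻¹ ^ k := by positivity
  rcases le_total 0 s.re with h | h
  · have e : kernel p q k z ω₁ ω₂ s = exp ((z - p * ω₁ - q * ω₂) * s)
        * (exp (ω₁ * s) * (exp (ω₁ * s) - 1)⁻¹) ^ p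
        * (exp (ω₂ * s) * (exp (ω₂ * s) - 1)⁻¹) ^ q * (s⁻¹) ^ k := by
      have : exp (z * s) = exp ((z - p * ω₁ - q * ω₂) * s) * exp (ω₁ * s) ^ p
          * exp (ω₂ * s) ^ q := by
        rw [← exp_nat_mul, ← exp_nat_mul, ← exp_add, ← exp_add]; ring_nf
      rw [kernel, this]; ring
    have := key (z - p * ω₁ - q * ω₂) hM₂ (by
      rw [abs_of_nonneg h]
      simp only [sub_re, mul_re, natCast_re, natCast_im, zero_mul, sub_zero]
      nlinarith)
    rw [e, norm_mul, norm_mul, norm_mul, norm_pow, norm_pow]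
    calc _ ≤ (Real.exp (M * |s.im|) * Real.exp (-δ * |s.re|)) * (1 + c) ^ p * (1 + c) ^ q
          * m⁻¹ ^ k := by
          gcongr
          · exact norm_exp_mul_inv_le hc h₁
          · exact norm_exp_mul_inv_le hc h₂
      _ = _ := by ring
  · have := key z hM₁ (by rw [abs_of_nonpos h]; nlinarith)
    rw [kernel, norm_mul, norm_mul, norm_mul, norm_pow, norm_pow]
    calc _ ≤ (Real.exp (M * |s.im|) * Real.exp (-δ * |s.re|)) * (1 + c) ^ p * (1 + c) ^ q
          * m⁻¹ ^ k := by
          gcongr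
          · linarith
          · linarith
      _ = _ := by ring

/-- Away from the imaginary axis `1 / (e ^ u - 1)` is bounded. -/
theorem norm_inv_exp_sub_one_le_of_abs_re {u : ℂ} {a : ℝ} (ha : 0 < a) (h : a ≤ |u.re|) :
    ‖(exp u - 1)⁻¹‖ ≤ (1 - Real.exp (-a))⁻¹ := by
  have hκ : 0 < 1 - Real.exp (-a) := by
    have : Real.exp (-a) < 1 := Real.exp_lt_one_iff.2 (by linarith)
    linarith
  rw [norm_inv]
  refine inv_anti₀ hκ ?_
  rcases le_abs.1 h with h | h
  · have h1 := norm_sub_norm_le (exp u) 1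
    rw [norm_exp, norm_one] at h1
    have h2 := Real.add_one_le_exp u.re
    have h3 := Real.add_one_le_exp (-a)
    linarith
  · have h1 := norm_sub_norm_le 1 (exp u)
    rw [norm_exp, norm_one, norm_sub_rev] at h1
    have h2 : Real.exp u.re ≤ Real.exp (-a) := Real.exp_le_exp.2 (by linarith)
    linarith

theorem norm_inv_exp_sub_one_le {u : ℂ} (h : 1 ≤ |u.re|) : ‖(exp u - 1)⁻¹‖ ≤ 2 := by
  refine (norm_inv_exp_sub_one_le_of_abs_re one_pos h).trans ?_
  have h1 : Real.exp (-1) ≤ 1 / 2 := by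
    rw [Real.exp_neg, inv_le_comm₀ (Real.exp_pos _) (by norm_num)]
    have := Real.add_one_le_exp (1 : ℝ)
    norm_num at *; linarith
  rw [inv_le_comm₀ (by linarith) (by norm_num)]
  linarith

theorem one_le_abs_re_mul {ω : ℂ} {r M y t : ℝ} (hr : 0 < r) (hωr : r ≤ ω.re) (hωM : ‖ω‖ ≤ M)
    (ht : (1 + M * |y|) / r ≤ |t|) : 1 ≤ |(ω * (t + y * I)).re| := by
  have e : (ω * (t + y * I)).re = ω.re * t - ω.im * y := by simp
  rw [div_le_iff₀ hr] at ht
  have h1 : |ω.im * y| ≤ M * |y| := by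
    rw [abs_mul]
    exact mul_le_mul_of_nonneg_right ((abs_im_le_norm ω).trans hωM) (abs_nonneg _)
  have h2 : |t| * r ≤ |ω.re * t| := by
    rw [abs_mul, abs_of_pos (hr.trans_le hωr), mul_comm]
    exact mul_le_mul_of_nonneg_right hωr (abs_nonneg _)
  rw [e]
  have := abs_sub_abs_le_abs_sub (ω.re * t) (ω.im * y)
  linarith

/-- The zeros of `e ^ (ω s) - 1` have imaginary part `0`, or at least `2π Re ω / |ω|²` in absolute
value. -/
theorem exp_mul_ne_one {ω s : ℂ} (hω : 0 < ω.re) (hs : 0 < s.im)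
    (h : s.im * ‖ω‖ ^ 2 < 2 * Real.pi * ω.re) : exp (ω * s) ≠ 1 := by
  intro h1
  obtain ⟨n, hn⟩ := exp_eq_one_iff.1 h1
  have hre := congrArg re hn
  have him := congrArg im hn
  simp at hre him
  have hnorm : ‖ω‖ ^ 2 = ω.re ^ 2 + ω.im ^ 2 := by
    rw [← normSq_eq_norm_sq, normSq_apply]; ring
  have hn2 : ω.re ^ 2 + ω.im ^ 2 > 0 := by positivity
  have e : s.im * (ω.re ^ 2 + ω.im ^ 2) = n * (2 * Real.pi) * ω.re := by
    linear_combination ω.re * him - ω.im * hre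
  have hn0 : (0 : ℝ) < n := by
    by_contra hh
    push Not at hh
    have : n * (2 * Real.pi) * ω.re ≤ 0 := by
      apply mul_nonpos_of_nonpos_of_nonneg _ hω.le
      exact mul_nonpos_of_nonpos_of_nonneg hh (by positivity)
    have : 0 < s.im * (ω.re ^ 2 + ω.im ^ 2) := by positivity
    linarith
  have hn1 : (1 : ℝ) ≤ n := by exact_mod_cast (by exact_mod_cast hn0 : (0 : ℤ) < n)
  rw [hnorm, e] at h
  have : 0 < 2 * Real.pi * ω.re := by positivity
  nlinarith

/-- On the line `Im s = η` the function `1 / (e ^ (ω s) - 1)` is bounded, locally uniformly in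
`ω`. -/
theorem exists_norm_inv_exp_sub_one_le {ω₀ : ℂ} {η : ℝ} (hη : 0 < η) (hω : 0 < ω₀.re)
    (h : η * ‖ω₀‖ ^ 2 < 2 * Real.pi * ω₀.re) :
    ∃ c : ℝ, 0 ≤ c ∧ ∀ᶠ ω in 𝓝 ω₀, ∀ t : ℝ, ‖(exp (ω * (t + η * I)) - 1)⁻¹‖ ≤ c := by
  set T : ℝ := (1 + (‖ω₀‖ + 1) * |η|) / (ω₀.re / 2)
  have hc : Continuous fun x : ℂ × ℝ => exp (x.1 * (x.2 + η * I)) - 1 := by fun_prop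
  have hne : ∀ t : ℝ, exp (ω₀ * (t + η * I)) - 1 ≠ 0 := fun t =>
    sub_ne_zero.2 (exp_mul_ne_one hω (by simpa using hη) (by simpa using h))
  have hc0 : Continuous fun t : ℝ => ‖(exp (ω₀ * (t + η * I)) - 1)⁻¹‖ :=
    (Continuous.inv₀ (by fun_prop) hne).norm
  obtain ⟨B, hB⟩ := (isCompact_Icc (a := -T) (b := T)).exists_bound_of_continuousOn hc0.continuousOn
  refine ⟨max 2 (B + 1), by positivity, ?_⟩
  have h1 : ∀ᶠ ω in 𝓝 ω₀, ∀ t ∈ Set.Icc (-T) T,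
      ‖(exp (ω * ((t : ℝ) + η * I)) - 1)⁻¹‖ ≤ B + 1 := by
    refine isCompact_Icc.eventually_forall_of_forall_eventually fun t ht => ?_
    have hca : ContinuousAt (fun x : ℂ × ℝ => ‖(exp (x.1 * (x.2 + η * I)) - 1)⁻¹‖) (ω₀, t) :=
      (hc.continuousAt.inv₀ (hne t)).norm
    have := hB t ht
    simp only [norm_norm] at this
    exact (hca.eventually_lt continuousAt_const
      (show _ < B + 1 by simpa using lt_of_le_of_lt this (lt_add_one B))).mono fun _ h => h.le
  have h2 : ∀ᶠ ω : ℂ in 𝓝 ω₀, ω₀.re / 2 < ω.re :=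
    continuous_re.continuousAt.eventually (lt_mem_nhds (by linarith : ω₀.re / 2 < ω₀.re))
  have h3 : ∀ᶠ ω : ℂ in 𝓝 ω₀, ‖ω‖ < ‖ω₀‖ + 1 :=
    continuous_norm.continuousAt.eventually (gt_mem_nhds (by linarith))
  filter_upwards [h1, h2, h3] with ω h1 h2 h3 t
  by_cases ht : |t| ≤ T
  · exact (h1 t (abs_le.1 ht)).trans (le_max_right _ _)
  · exact (norm_inv_exp_sub_one_le (one_le_abs_re_mul (by linarith) h2.le h3.le
      (not_le.1 ht).le)).trans (le_max_left _ _)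

theorem Adm.eventually {p q : ℕ} {η : ℝ} {x : ℂ × ℂ × ℂ} (h : Adm p q η x.1 x.2.1 x.2.2) :
    ∀ᶠ y : ℂ × ℂ × ℂ in 𝓝 x, Adm p q η y.1 y.2.1 y.2.2 := by
  have c1 : Continuous fun y : ℂ × ℂ × ℂ => y.2.1.re := by fun_prop
  have c2 : Continuous fun y : ℂ × ℂ × ℂ => y.2.2.re := by fun_prop
  have c3 : Continuous fun y : ℂ × ℂ × ℂ => y.1.re := by fun_prop
  have c4 : Continuous fun y : ℂ × ℂ × ℂ => η * ‖y.2.1‖ ^ 2 := by fun_prop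
  have c5 : Continuous fun y : ℂ × ℂ × ℂ => η * ‖y.2.2‖ ^ 2 := by fun_prop
  have e1 := continuousAt_const.eventually_lt c1.continuousAt h.re₁
  have e2 := continuousAt_const.eventually_lt c2.continuousAt h.re₂
  have e3 := continuousAt_const.eventually_lt c3.continuousAt h.z_pos
  have e4 := c4.continuousAt.eventually_lt (c1.const_mul (2 * Real.pi)).continuousAt h.lt₁
  have e5 := c5.continuousAt.eventually_lt (c2.const_mul (2 * Real.pi)).continuousAt h.lt₂
  have e6 := c3.continuousAt.eventually_lt
    ((c1.const_mul (p : ℝ)).add (c2.const_mul (q : ℝ))).continuousAt h.z_lt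
  filter_upwards [e1, e2, e3, e4, e5, e6] with y e1 e2 e3 e4 e5 e6
  exact ⟨h.η_pos, e1, e2, e4, e5, e3, e6⟩

/-- The integrand decays exponentially along the line, locally uniformly in the parameters. This
dominates all limits and derivatives under the integral sign. -/
theorem Adm.exists_bound {p q : ℕ} {η : ℝ} {x : ℂ × ℂ × ℂ}
    (h : Adm p q η x.1 x.2.1 x.2.2) (k : ℕ) :
    ∃ C δ : ℝ, 0 ≤ C ∧ 0 < δ ∧ ∀ᶠ y : ℂ × ℂ × ℂ in 𝓝 x, ∀ t : ℝ,
      ‖kernel p q k y.1 y.2.1 y.2.2 (t + η * I)‖ ≤ C * Real.exp (-δ * |t|) := by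
  obtain ⟨c₁, hc₁, h₁⟩ := exists_norm_inv_exp_sub_one_le h.η_pos h.re₁ h.lt₁
  obtain ⟨c₂, hc₂, h₂⟩ := exists_norm_inv_exp_sub_one_le h.η_pos h.re₂ h.lt₂
  set a := x.1.re
  set b := p * x.2.1.re + q * x.2.2.re - x.1.re with hb
  have ha : 0 < a := h.z_pos
  have hb0 : 0 < b := by have := h.z_lt; simp only [hb]; linarith
  set δ := min (a / 2) (b / 2)
  have hδ : 0 < δ := by positivity
  set M := max (‖x.1‖ + 1) (‖x.1 - p * x.2.1 - q * x.2.2‖ + 1)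
  set c := max c₁ c₂
  refine ⟨(1 + c) ^ p * (1 + c) ^ q * η⁻¹ ^ k * Real.exp (M * |η|), δ, ?_, hδ, ?_⟩
  · have := h.η_pos
    positivity
  have e1 : ∀ᶠ y : ℂ × ℂ × ℂ in 𝓝 x, a / 2 < y.1.re :=
    continuousAt_const.eventually_lt (by fun_prop) (by simp only [a] at ha ⊢; linarith)
  have e2 : ∀ᶠ y : ℂ × ℂ × ℂ in 𝓝 x, b / 2 < p * y.2.1.re + q * y.2.2.re - y.1.re :=
    continuousAt_const.eventually_lt (by fun_prop) (by rw [← hb]; linarith)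
  have e3 : ∀ᶠ y : ℂ × ℂ × ℂ in 𝓝 x, ‖y.1‖ < ‖x.1‖ + 1 :=
    ContinuousAt.eventually_lt (by fun_prop) continuousAt_const (by linarith)
  have e4 : ∀ᶠ y : ℂ × ℂ × ℂ in 𝓝 x,
      ‖y.1 - p * y.2.1 - q * y.2.2‖ < ‖x.1 - p * x.2.1 - q * x.2.2‖ + 1 :=
    ContinuousAt.eventually_lt (by fun_prop) continuousAt_const (by linarith)
  have e5 := (continuous_fst.comp continuous_snd).continuousAt.eventually h₁
  have e6 := (continuous_snd.comp continuous_snd).continuousAt.eventually h₂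
  filter_upwards [e1, e2, e3, e4, e5, e6] with y e1 e2 e3 e4 e5 e6 t
  have := norm_kernel_le (p := p) (q := q) (k := k) (z := y.1) (ω₁ := y.2.1) (ω₂ := y.2.2)
    (s := t + η * I) (c := c) (m := η) (δ := δ) (M := M) (by positivity) h.η_pos
    (by simpa [abs_of_pos h.η_pos] using abs_im_le_norm ((t : ℂ) + η * I))
    ((e5 t).trans (le_max_left _ _)) ((e6 t).trans (le_max_right _ _))
    ((min_le_left _ _).trans e1.le) ((min_le_right _ _).trans e2.le)
    (e3.le.trans (le_max_left _ _)) (e4.le.trans (le_max_right _ _))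
  simpa using this

theorem integrable_exp_neg_mul_abs {δ : ℝ} (hδ : 0 < δ) (C : ℝ) :
    Integrable fun t : ℝ => C * Real.exp (-δ * |t|) := by
  refine Integrable.const_mul ?_ C
  have h1 : IntegrableOn (fun t : ℝ => Real.exp (-δ * |t|)) (Set.Ioi 0) :=
    (exp_neg_integrableOn_Ioi 0 hδ).congr_fun
      (fun t ht => by simp only [abs_of_pos (Set.mem_Ioi.1 ht)]) measurableSet_Ioi
  have h2 : IntegrableOn (fun t : ℝ => Real.exp (-δ * |t|)) (Set.Iic 0) :=
    (integrableOn_exp_mul_Iic hδ 0).congr_fun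
      (fun t ht => by simp only [abs_of_nonpos (Set.mem_Iic.1 ht)]; ring_nf) measurableSet_Iic
  rw [← integrableOn_univ, ← Set.Iic_union_Ioi (a := (0 : ℝ))]
  exact h2.union h1

theorem Adm.exp_ne₁ {p q : ℕ} {η : ℝ} {z ω₁ ω₂ : ℂ} (h : Adm p q η z ω₁ ω₂) (t : ℝ) :
    exp (ω₁ * (t + η * I)) - 1 ≠ 0 :=
  sub_ne_zero.2 (exp_mul_ne_one h.re₁ (by simpa using h.η_pos) (by simpa using h.lt₁))

theorem Adm.exp_ne₂ {p q : ℕ} {η : ℝ} {z ω₁ ω₂ : ℂ} (h : Adm p q η z ω₁ ω₂) (t : ℝ) :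
    exp (ω₂ * (t + η * I)) - 1 ≠ 0 :=
  sub_ne_zero.2 (exp_mul_ne_one h.re₂ (by simpa using h.η_pos) (by simpa using h.lt₂))

theorem line_ne_zero {η : ℝ} (h : 0 < η) (t : ℝ) : (t : ℂ) + η * I ≠ 0 := by
  intro h0
  have := congrArg im h0
  simp at this
  exact h.ne' this

theorem Adm.continuous_kernel {p q : ℕ} {η : ℝ} {z ω₁ ω₂ : ℂ} (h : Adm p q η z ω₁ ω₂) (k : ℕ) :
    Continuous fun t : ℝ => kernel p q k z ω₁ ω₂ (t + η * I) := by
  unfold kernel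
  refine ((Continuous.mul (by fun_prop) ?_).mul ?_).mul ?_
  · exact (Continuous.inv₀ (by fun_prop) h.exp_ne₁).pow _
  · exact (Continuous.inv₀ (by fun_prop) h.exp_ne₂).pow _
  · exact (Continuous.inv₀ (by fun_prop) (line_ne_zero h.η_pos)).pow _

theorem Adm.integrable {p q : ℕ} {η : ℝ} {z ω₁ ω₂ : ℂ} (h : Adm p q η z ω₁ ω₂) (k : ℕ) :
    Integrable fun t : ℝ => kernel p q k z ω₁ ω₂ (t + η * I) := by
  obtain ⟨C, δ, -, hδ, hb⟩ := Adm.exists_bound (x := (z, ω₁, ω₂)) h k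
  exact (integrable_exp_neg_mul_abs hδ C).mono' (h.continuous_kernel k).aestronglyMeasurable
    (ae_of_all _ fun t => hb.self_of_nhds t)

theorem Adm.continuousAt {p q : ℕ} {η : ℝ} {x : ℂ × ℂ × ℂ} (h : Adm p q η x.1 x.2.1 x.2.2)
    (k : ℕ) : ContinuousAt (fun y : ℂ × ℂ × ℂ => lineInt p q k η y.1 y.2.1 y.2.2) x := by
  obtain ⟨C, δ, -, hδ, hb⟩ := h.exists_bound k
  refine continuousAt_of_dominated (bound := fun t => C * Real.exp (-δ * |t|))
    (h.eventually.mono fun y hy => (hy.continuous_kernel k).aestronglyMeasurable)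
    (hb.mono fun y hy => ae_of_all _ hy) (integrable_exp_neg_mul_abs hδ C)
    (ae_of_all _ fun t => ?_)
  unfold kernel
  refine ((ContinuousAt.mul (by fun_prop) ?_).mul ?_).mul continuousAt_const
  · have hc : ContinuousAt (fun y : ℂ × ℂ × ℂ => exp (y.2.1 * (t + η * I)) - 1) x := by fun_prop
    exact (hc.inv₀ (h.exp_ne₁ t)).pow p
  · have hc : ContinuousAt (fun y : ℂ × ℂ × ℂ => exp (y.2.2 * (t + η * I)) - 1) x := by fun_prop
    exact (hc.inv₀ (h.exp_ne₂ t)).pow q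

theorem Adm.hasDerivAt_z {p q : ℕ} {η : ℝ} {z ω₁ ω₂ : ℂ} (h : Adm p q η z ω₁ ω₂) (k : ℕ) :
    HasDerivAt (fun z => lineInt p q (k + 1) η z ω₁ ω₂) (lineInt p q k η z ω₁ ω₂) z := by
  have hc : ContinuousAt (fun z : ℂ => (z, ω₁, ω₂)) z := by fun_prop
  obtain ⟨C, δ, -, hδ, hb⟩ := Adm.exists_bound (x := (z, ω₁, ω₂)) h k
  have hb' := hc.eventually hb
  refine (hasDerivAt_integral_of_dominated_loc_of_deriv_le (𝕜 := ℂ)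
    (F := fun z (t : ℝ) => kernel p q (k + 1) z ω₁ ω₂ (t + η * I))
    (F' := fun z (t : ℝ) => kernel p q k z ω₁ ω₂ (t + η * I))
    (bound := fun t => C * Real.exp (-δ * |t|)) hb'
    ?_ (h.integrable (k + 1)) (h.continuous_kernel k).aestronglyMeasurable
    (ae_of_all _ fun t y hy => hy t) (integrable_exp_neg_mul_abs hδ C)
    (ae_of_all _ fun t y _ => ?_)).2
  · exact (hc.eventually (Adm.eventually (x := (z, ω₁, ω₂)) h)).mono fun y hy =>
      (hy.continuous_kernel (k + 1)).aestronglyMeasurable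
  · have h0 := line_ne_zero h.η_pos t
    have h1 := ((hasDerivAt_id y).mul_const ((t : ℂ) + η * I)).cexp
    have h2 := ((h1.mul_const (((exp (ω₁ * (t + η * I)) - 1)⁻¹) ^ p)).mul_const
      (((exp (ω₂ * (t + η * I)) - 1)⁻¹) ^ q)).mul_const ((((t : ℂ) + η * I)⁻¹) ^ (k + 1))
    refine h2.congr_deriv ?_
    simp only [kernel, id]
    field_simp
    rw [pow_succ]
    field_simp

/-! ### Invariance under rotation and integration by parts -/

theorem hasDerivAt_inv_pow {f : ℂ → ℂ} {f' x : ℂ} (hf : HasDerivAt f f' x) (h : f x ≠ 0)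
    (p : ℕ) :
    HasDerivAt (fun y => ((f y)⁻¹) ^ p) (-(p * f') * ((f x)⁻¹) ^ (p + 1)) x := by
  refine ((hf.fun_inv h).fun_pow p).congr_deriv ?_
  rcases p with _ | p
  · simp
  · simp only [Nat.add_sub_cancel]
    rw [pow_succ _ (p + 1), pow_succ _ p]
    field_simp

theorem hasDerivAt_inv_exp_sub_one_pow {g : ℂ → ℂ} {g' x : ℂ} (hg : HasDerivAt g g' x)
    (h : exp (g x) - 1 ≠ 0) (p : ℕ) :
    HasDerivAt (fun y => ((exp (g y) - 1)⁻¹) ^ p)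
      (-(p * (exp (g x) * g')) * ((exp (g x) - 1)⁻¹) ^ (p + 1)) x :=
  hasDerivAt_inv_pow (hg.cexp.sub_const 1) h p

theorem hasDerivAt_line {f : ℂ → ℂ} {f' : ℂ} {η t : ℝ} (h : HasDerivAt f f' (t + η * I)) :
    HasDerivAt (fun t : ℝ => f (t + η * I)) f' t :=
  (h.comp_add_const (t : ℂ) (η * I)).comp_ofReal

theorem Adm.add₁ {p q : ℕ} {η : ℝ} {z ω₁ ω₂ : ℂ} (h : Adm p q η z ω₁ ω₂) :
    Adm (p + 1) q η (z + ω₁) ω₁ ω₂ := by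
  obtain ⟨h1, h2, h3, h4, h5, h6, h7⟩ := h
  refine ⟨h1, h2, h3, h4, h5, by simp; linarith, by push_cast; simp; linarith⟩

theorem Adm.add₂ {p q : ℕ} {η : ℝ} {z ω₁ ω₂ : ℂ} (h : Adm p q η z ω₁ ω₂) :
    Adm p (q + 1) η (z + ω₂) ω₁ ω₂ := by
  obtain ⟨h1, h2, h3, h4, h5, h6, h7⟩ := h
  refine ⟨h1, h2, h3, h4, h5, by simp; linarith, by push_cast; simp; linarith⟩

theorem hasDerivAt_kernel_s {p q k : ℕ} {z ω₁ ω₂ s : ℂ} (h₁ : exp (ω₁ * s) - 1 ≠ 0)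
    (h₂ : exp (ω₂ * s) - 1 ≠ 0) (hs : s ≠ 0) :
    HasDerivAt (kernel p q k z ω₁ ω₂)
      (z * kernel p q k z ω₁ ω₂ s - p * ω₁ * kernel (p + 1) q k (z + ω₁) ω₁ ω₂ s
        - q * ω₂ * kernel p (q + 1) k (z + ω₂) ω₁ ω₂ s - k * kernel p q (k + 1) z ω₁ ω₂ s) s := by
  have d0 := ((hasDerivAt_id s).const_mul z).cexp
  have d1 := hasDerivAt_inv_exp_sub_one_pow ((hasDerivAt_id s).const_mul ω₁) h₁ p
  have d2 := hasDerivAt_inv_exp_sub_one_pow ((hasDerivAt_id s).const_mul ω₂) h₂ q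
  have d3 := hasDerivAt_inv_pow (hasDerivAt_id s) hs k
  refine (((d0.fun_mul d1).fun_mul d2).fun_mul d3).congr_deriv ?_
  simp only [kernel, add_mul, exp_add, id]
  ring

theorem hasDerivAt_kernel_smul {p q : ℕ} {z ω₁ ω₂ s l : ℂ} (h₁ : exp (l * ω₁ * s) - 1 ≠ 0)
    (h₂ : exp (l * ω₂ * s) - 1 ≠ 0) (hs : s ≠ 0) :
    HasDerivAt (fun l => kernel p q 1 (l * z) (l * ω₁) (l * ω₂) s)
      (z * kernel p q 0 (l * z) (l * ω₁) (l * ω₂) s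
        - p * ω₁ * kernel (p + 1) q 0 (l * (z + ω₁)) (l * ω₁) (l * ω₂) s
        - q * ω₂ * kernel p (q + 1) 0 (l * (z + ω₂)) (l * ω₁) (l * ω₂) s) l := by
  have d (a : ℂ) : HasDerivAt (fun l => l * a * s) (a * s) l := by
    simpa using ((hasDerivAt_id l).mul_const a).mul_const s
  have d1 := hasDerivAt_inv_exp_sub_one_pow (d ω₁) h₁ p
  have d2 := hasDerivAt_inv_exp_sub_one_pow (d ω₂) h₂ q
  refine ((((d z).cexp.fun_mul d1).fun_mul d2).mul_const ((s⁻¹) ^ 1)).congr_deriv ?_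
  simp only [kernel, mul_add, add_mul, exp_add, pow_zero, mul_one, pow_one]
  field_simp
  ring

/-- The line integral does not change under an infinitesimal rotation and rescaling of
`(z, ω₁, ω₂)`: the derivative of the integrand is a total derivative in `s`. This replaces the
rotation of the contour. -/
theorem Adm.hasDerivAt_smul {p q : ℕ} {η : ℝ} {z ω₁ ω₂ l : ℂ}
    (h : Adm p q η (l * z) (l * ω₁) (l * ω₂)) :
    HasDerivAt (fun l => lineInt p q 1 η (l * z) (l * ω₁) (l * ω₂)) 0 l := by
  have h1 := h.add₁
  have h2 := h.add₂
  rw [← mul_add] at h1 h2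
  set D : ℂ → ℝ → ℂ := fun l t => z * kernel p q 0 (l * z) (l * ω₁) (l * ω₂) (t + η * I)
        - p * ω₁ * kernel (p + 1) q 0 (l * (z + ω₁)) (l * ω₁) (l * ω₂) (t + η * I)
        - q * ω₂ * kernel p (q + 1) 0 (l * (z + ω₂)) (l * ω₁) (l * ω₂) (t + η * I) with hD
  have hc (a : ℂ) : ContinuousAt (fun l : ℂ => (l * a, l * ω₁, l * ω₂)) l := by fun_prop
  obtain ⟨C, δ, -, hδ, hb⟩ := Adm.exists_bound (x := (l * z, l * ω₁, l * ω₂)) h 0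
  obtain ⟨C₁, δ₁, -, hδ₁, hb₁⟩ := Adm.exists_bound (x := (l * (z + ω₁), l * ω₁, l * ω₂)) h1 0
  obtain ⟨C₂, δ₂, -, hδ₂, hb₂⟩ := Adm.exists_bound (x := (l * (z + ω₂), l * ω₁, l * ω₂)) h2 0
  have hadm := (hc z).eventually (Adm.eventually (x := (l * z, l * ω₁, l * ω₂)) h)
  have hev := (((hc z).eventually hb).and ((hc (z + ω₁)).eventually hb₁)).and
    (((hc (z + ω₂)).eventually hb₂).and hadm)
  have hDc : Continuous (D l) := by
    simp only [hD]
    exact ((continuous_const.mul (h.continuous_kernel 0)).sub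
      (continuous_const.mul (h1.continuous_kernel 0))).sub
      (continuous_const.mul (h2.continuous_kernel 0))
  have hDi : Integrable (D l) := by
    simp only [hD]
    exact (((h.integrable 0).const_mul _).sub ((h1.integrable 0).const_mul _)).sub
      ((h2.integrable 0).const_mul _)
  have main := (hasDerivAt_integral_of_dominated_loc_of_deriv_le (𝕜 := ℂ)
    (F := fun l (t : ℝ) => kernel p q 1 (l * z) (l * ω₁) (l * ω₂) (t + η * I))
    (F' := D)
    (bound := fun t => ‖z‖ * (C * Real.exp (-δ * |t|))
      + ‖p * ω₁‖ * (C₁ * Real.exp (-δ₁ * |t|)) + ‖q * ω₂‖ * (C₂ * Real.exp (-δ₂ * |t|)))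
    hev
    (hadm.mono fun y hy => (hy.continuous_kernel 1).aestronglyMeasurable)
    (h.integrable 1) hDc.aestronglyMeasurable
    (ae_of_all _ fun t y hy => ?_)
    ((((integrable_exp_neg_mul_abs hδ C).const_mul _).add
      ((integrable_exp_neg_mul_abs hδ₁ C₁).const_mul _)).add
      ((integrable_exp_neg_mul_abs hδ₂ C₂).const_mul _))
    (ae_of_all _ fun t y hy => ?_)).2
  · refine main.congr_deriv ?_
    -- the derivative of the integrand is, up to the factor `l`, a derivative along the line
    have hd : ∀ t : ℝ, HasDerivAt
        (fun t : ℝ => kernel p q 0 (l * z) (l * ω₁) (l * ω₂) (t + η * I)) (l * D l t) t := by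
      intro t
      refine (hasDerivAt_line (hasDerivAt_kernel_s (h.exp_ne₁ t) (h.exp_ne₂ t)
        (line_ne_zero h.η_pos t))).congr_deriv ?_
      simp only [hD, mul_add, Nat.cast_zero, zero_mul, sub_zero]
      ring
    have h0 := integral_eq_zero_of_hasDerivAt_of_integrable hd (hDi.const_mul l) (h.integrable 0)
    rw [integral_const_mul] at h0
    refine (mul_eq_zero.1 h0).resolve_left ?_
    rintro rfl
    have := h.re₁
    simp at this
  · obtain ⟨⟨a, b⟩, c, -⟩ := hy
    simp only [hD]
    refine (norm_sub_le _ _).trans (add_le_add ((norm_sub_le _ _).trans (add_le_add ?_ ?_)) ?_)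
    all_goals rw [norm_mul]; gcongr
    exacts [a t, b t, c t]
  · exact hasDerivAt_kernel_smul (hy.2.2.exp_ne₁ t) (hy.2.2.exp_ne₂ t) (line_ne_zero h.η_pos t)

/-- Integration by parts reduces the double pole in `G` to polylogarithms. -/
theorem Adm.lineInt_two {η : ℝ} {z ω₁ ω₂ : ℂ} (h : Adm 1 0 η z ω₁ ω₂) (k : ℕ) :
    ω₁ * lineInt 2 0 k η (z + ω₁) ω₁ ω₂
      = z * lineInt 1 0 k η z ω₁ ω₂ - k * lineInt 1 0 (k + 1) η z ω₁ ω₂ := by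
  have h1 := h.add₁
  have hd : ∀ t : ℝ, HasDerivAt (fun t : ℝ => kernel 1 0 k z ω₁ ω₂ (t + η * I))
      (z * kernel 1 0 k z ω₁ ω₂ (t + η * I)
        - ω₁ * kernel 2 0 k (z + ω₁) ω₁ ω₂ (t + η * I)
        - k * kernel 1 0 (k + 1) z ω₁ ω₂ (t + η * I)) t := by
    intro t
    refine (hasDerivAt_line (hasDerivAt_kernel_s (h.exp_ne₁ t) (h.exp_ne₂ t)
      (line_ne_zero h.η_pos t))).congr_deriv ?_
    simp
  have i1 := (h.integrable k).const_mul z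
  have i2 := (h1.integrable k).const_mul ω₁
  have i3 := (h.integrable (k + 1)).const_mul (k : ℂ)
  have h0 := integral_eq_zero_of_hasDerivAt_of_integrable hd ((i1.sub i2).sub i3) (h.integrable k)
  rw [integral_sub (by exact i1.sub i2) i3, integral_sub i1 i2, integral_const_mul,
    integral_const_mul,
    integral_const_mul] at h0
  simp only [lineInt]
  linear_combination -h0

/-! ### The integral with a single period -/

/-- The reflection formula for `Γ`, in the form of a Fourier integral. -/
theorem integral_exp_mul_div_exp_add_one {z : ℂ} (h0 : 0 < z.re) (h1 : z.re < 1) :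
    ∫ t : ℝ, exp (z * t) * (exp t + 1)⁻¹ = Real.pi / sin (Real.pi * z) := by
  have hb := Gamma_mul_Gamma_eq_betaIntegral (s := z) (t := 1 - z) h0 (by simpa using h1)
  rw [add_sub_cancel, Gamma_one, one_mul, Gamma_mul_Gamma_one_sub] at hb
  rw [hb, betaIntegral, intervalIntegral.integral_of_le zero_le_one,
    integral_Ioc_eq_integral_Ioo, ← Real.range_sigmoid, ← Set.image_univ,
    integral_image_eq_integral_abs_deriv_smul MeasurableSet.univ
      (fun t _ => (Real.hasDerivAt_sigmoid t).hasDerivWithinAt)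
      Real.sigmoid_injective.injOn, setIntegral_univ]
  refine integral_congr_ae (ae_of_all _ fun t => ?_)
  have hp : 0 < Real.sigmoid t := Real.sigmoid_pos t
  have hq : 0 < 1 - Real.sigmoid t := by linarith [Real.sigmoid_lt_one t]
  have e1 : (1 - Real.sigmoid t) = (Real.exp t + 1)⁻¹ := by
    rw [Real.sigmoid_def, Real.exp_neg]
    field_simp; ring
  have e2 : Real.sigmoid t = Real.exp t * (Real.exp t + 1)⁻¹ := by
    linarith [show Real.exp t * (Real.exp t + 1)⁻¹ + (Real.exp t + 1)⁻¹ = 1 by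
      have := Real.exp_pos t
      field_simp]
  set a := Real.exp t with ha
  set b := (Real.exp t + 1)⁻¹ with hb
  have hb0 : 0 < b := by positivity
  simp only [abs_of_pos (mul_pos hp hq)]
  rw [show (1 - (Real.sigmoid t : ℂ)) = ((1 - Real.sigmoid t : ℝ) : ℂ) by push_cast; rfl, e1,
    e2, real_smul]
  push_cast
  rw [mul_cpow_ofReal_nonneg (Real.exp_pos t).le hb0.le]
  have hbc : (b : ℂ) ≠ 0 := by exact_mod_cast hb0.ne'
  have e3 : (b : ℂ) ^ (z - 1) * (b : ℂ) ^ (1 - z - 1) = (b : ℂ)⁻¹ := by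
    rw [← cpow_add _ _ hbc, ← cpow_neg_one]; ring_nf
  have e4 : (a : ℂ) ^ (z - 1) = exp (z * t) * (a : ℂ)⁻¹ := by
    rw [ha, ofReal_exp, cpow_def_of_ne_zero (exp_ne_zero _), ← ofReal_exp, ← ofReal_log
      (Real.exp_pos t).le, Real.log_exp, ofReal_exp, ← exp_neg, ← exp_add]
    ring_nf
  have hac : (a : ℂ) ≠ 0 := by exact_mod_cast (Real.exp_pos t).ne'
  rw [e4, show exp (t : ℂ) = (a : ℂ) by rw [ha, ofReal_exp]]
  have : ((a : ℂ) + 1)⁻¹ = b := by rw [hb, ← ha]; push_cast; rfl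
  rw [this, mul_assoc, mul_assoc (exp (z * t)), mul_assoc, mul_assoc, mul_assoc, e3]
  field_simp

/-- For `ω = 1` and `η = π` the denominator becomes `-(e ^ t + 1)`, and there is no pole to avoid. -/
theorem lineInt_pi {z : ℂ} (h0 : 0 < z.re) (h1 : z.re < 1) :
    lineInt 1 0 0 Real.pi z 1 1
      = 2 * Real.pi * I * exp (2 * Real.pi * I * z) / (1 - exp (2 * Real.pi * I * z)) := by
  have e : ∀ t : ℝ, kernel 1 0 0 z 1 1 (t + Real.pi * I)
      = -exp (Real.pi * I * z) * (exp (z * t) * (exp t + 1)⁻¹) := by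
    intro t
    simp only [kernel, one_mul, pow_one, pow_zero, mul_one, mul_add, exp_add, exp_pi_mul_I]
    rw [show exp (t : ℂ) * -1 - 1 = -(exp t + 1) by ring, inv_neg,
      show z * (Real.pi * I) = Real.pi * I * z by ring]
    ring
  simp only [lineInt, e]
  rw [integral_const_mul, integral_exp_mul_div_exp_add_one h0 h1, sin]
  set X := exp (Real.pi * I * z) with hX
  have hX0 : X ≠ 0 := exp_ne_zero _
  have e1 : exp (2 * Real.pi * I * z) = X ^ 2 := by rw [hX, ← exp_nat_mul]; ring_nf
  have e2 : exp (Real.pi * z * I) = X := by rw [hX]; ring_nf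
  have e3 : exp (-(Real.pi * z) * I) = X⁻¹ := by rw [hX, ← exp_neg]; ring_nf
  rw [e1, e2, e3]
  have hne : X ^ 2 ≠ 1 := by
    rw [← e1]
    intro h
    obtain ⟨n, hn⟩ := exp_eq_one_iff.1 h
    have : z = n := by
      have h2 : (2 * Real.pi * I : ℂ) ≠ 0 := by simp
      exact mul_left_cancel₀ h2 (by rw [hn]; ring)
    rw [this] at h0 h1
    simp only [intCast_re] at h0 h1
    have a1 : 0 < n := by exact_mod_cast h0
    have a2 : n < 1 := by exact_mod_cast h1
    omega
  have hI : I ^ 2 = -1 := I_sq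
  have h1 : (1 - X ^ 2) ≠ 0 := sub_ne_zero.2 (Ne.symm hne)
  have h2 : (X⁻¹ - X) * I / 2 ≠ 0 := by
    have : X⁻¹ - X = (1 - X ^ 2) / X := by field_simp
    rw [this]
    simp [h1, hX0]
  rw [eq_div_iff h1, mul_div_assoc', div_mul_eq_mul_div, div_eq_iff h2]
  field_simp
  rw [I_sq]

theorem lineInt_real_smul {p q : ℕ} {η r : ℝ} (hr : 0 < r) (z ω₁ ω₂ : ℂ) :
    lineInt p q 1 η (r * z) (r * ω₁) (r * ω₂) = lineInt p q 1 (r * η) z ω₁ ω₂ := by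
  have e : ∀ t : ℝ, kernel p q 1 (r * z) (r * ω₁) (r * ω₂) (t + η * I)
      = r • kernel p q 1 z ω₁ ω₂ (((r * t : ℝ) : ℂ) + ((r * η : ℝ) : ℂ) * I) := by
    intro t
    have hr' : (r : ℂ) ≠ 0 := by exact_mod_cast hr.ne'
    have : ((r * t : ℝ) : ℂ) + ((r * η : ℝ) : ℂ) * I = r * (t + η * I) := by push_cast; ring
    rw [this]
    have h (a : ℂ) : r * a * (t + η * I) = a * (r * (t + η * I)) := by ring
    simp only [kernel, h, real_smul, pow_one, mul_inv]
    field_simp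
  simp only [lineInt, e]
  rw [integral_smul,
    Measure.integral_comp_mul_left (fun t : ℝ => kernel p q 1 z ω₁ ω₂ (t + ((r * η : ℝ) : ℂ) * I)),
    smul_smul, abs_of_pos (inv_pos.2 hr), mul_inv_cancel₀ hr.ne', one_smul]

/-- All conditions in `Adm` are convex in the scaling factor: `η |l ω|² < 2π Re (l ω)` describes a
disc. -/
theorem convex_adm (p q : ℕ) (η : ℝ) (z ω₁ ω₂ : ℂ) :
    Convex ℝ {l : ℂ | Adm p q η (l * z) (l * ω₁) (l * ω₂)} := by
  intro l hl m hm a b ha hb hab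
  have lin (x : ℂ) : ((a • l + b • m) * x).re = a * (l * x).re + b * (m * x).re := by
    simp; ring
  have pos {x y : ℝ} (hx : 0 < x) (hy : 0 < y) : 0 < a * x + b * y := by
    rcases ha.eq_or_lt with rfl | ha
    · have : b = 1 := by linarith
      simp [this, hy]
    · have := mul_pos ha hx
      have := mul_nonneg hb hy.le
      linarith
  have sq (x : ℂ) : ‖(a • l + b • m) * x‖ ^ 2 ≤ a * ‖l * x‖ ^ 2 + b * ‖m * x‖ ^ 2 := by
    have h1 : ‖(a • l + b • m) * x‖ ≤ a * ‖l * x‖ + b * ‖m * x‖ := by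
      have : (a • l + b • m) * x = a • (l * x) + b • (m * x) := by
        simp only [real_smul]; ring
      rw [this]
      refine (norm_add_le _ _).trans (le_of_eq ?_)
      rw [norm_smul, norm_smul, Real.norm_of_nonneg ha, Real.norm_of_nonneg hb]
    have h2 : ‖(a • l + b • m) * x‖ ^ 2 ≤ (a * ‖l * x‖ + b * ‖m * x‖) ^ 2 := by gcongr
    have h3 : 0 ≤ a * b * (‖l * x‖ - ‖m * x‖) ^ 2 := by positivity
    obtain rfl : b = 1 - a := by linarith
    nlinarith
  obtain ⟨h1, h2, h3, h4, h5, h6, h7⟩ := hl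
  obtain ⟨g1, g2, g3, g4, g5, g6, g7⟩ := hm
  refine ⟨h1, ?_, ?_, ?_, ?_, ?_, ?_⟩
  · rw [lin]; exact pos h2 g2
  · rw [lin]; exact pos h3 g3
  · have := pos (sub_pos.2 h4) (sub_pos.2 g4)
    have := mul_le_mul_of_nonneg_left (sq ω₁) h1.le
    rw [lin]; linarith
  · have := pos (sub_pos.2 h5) (sub_pos.2 g5)
    have := mul_le_mul_of_nonneg_left (sq ω₂) h1.le
    rw [lin]; linarith
  · rw [lin]; exact pos h6 g6
  · have := pos (sub_pos.2 h7) (sub_pos.2 g7)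
    rw [lin, lin, lin]; linarith

theorem lineInt_smul_congr {p q : ℕ} {η : ℝ} {z ω₁ ω₂ l m : ℂ}
    (hl : Adm p q η (l * z) (l * ω₁) (l * ω₂)) (hm : Adm p q η (m * z) (m * ω₁) (m * ω₂)) :
    lineInt p q 1 η (l * z) (l * ω₁) (l * ω₂) = lineInt p q 1 η (m * z) (m * ω₁) (m * ω₂) := by
  have ho : IsOpen {l : ℂ | Adm p q η (l * z) (l * ω₁) (l * ω₂)} := by
    rw [isOpen_iff_mem_nhds]
    intro l hl
    have hc : ContinuousAt (fun l : ℂ => (l * z, l * ω₁, l * ω₂)) l := by fun_prop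
    exact hc.eventually (Adm.eventually (x := (l * z, l * ω₁, l * ω₂)) hl)
  exact ho.is_const_of_deriv_eq_zero (convex_adm p q η z ω₁ ω₂).isPreconnected
    (fun l (hl : Adm _ _ _ _ _ _) => hl.hasDerivAt_smul.differentiableAt.differentiableWithinAt)
    (fun l (hl : Adm _ _ _ _ _ _) => hl.hasDerivAt_smul.deriv) hl hm

/-- Rotation to `ω = 1`. The parameter `ω₂` plays no role if `q = 0`, and is taken equal to `ω₁`. -/
theorem lineInt_one_one_eq {η : ℝ} {z ω : ℂ} (h : Adm 1 0 η z ω ω) (h0 : 0 < (z / ω).re)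
    (h1 : (z / ω).re < 1) : lineInt 1 0 1 η z ω ω = lineInt 1 0 1 Real.pi (z / ω) 1 1 := by
  have hω : ω ≠ 0 := by rintro rfl; simpa using h.re₁
  have hη := h.η_pos
  have hπ := Real.pi_pos
  have hpi : Adm 1 0 Real.pi (1 * (z / ω)) (1 * 1) (1 * 1) :=
    ⟨hπ, by simp, by simp, by simp; linarith, by simp; linarith, by simpa using h0,
      by simpa using h1⟩
  have e : ((η / Real.pi : ℝ) * ω) * (z / ω) = (η / Real.pi : ℝ) * z := by field_simp
  have hr : 0 < η / Real.pi := by positivity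
  have l1 : Real.pi * ‖((η / Real.pi : ℝ) : ℂ) * ω‖ ^ 2
      < 2 * Real.pi * (((η / Real.pi : ℝ) : ℂ) * ω).re := by
    rw [norm_mul, norm_real, Real.norm_of_nonneg hr.le, re_ofReal_mul]
    have h2 := h.lt₁
    have e1 : Real.pi * (η / Real.pi * ‖ω‖) ^ 2 = (η / Real.pi) * (η * ‖ω‖ ^ 2) := by
      field_simp
    rw [e1]
    calc _ < (η / Real.pi) * (2 * Real.pi * ω.re) := by gcongr
      _ = _ := by ring
  have hl : Adm 1 0 Real.pi (((η / Real.pi : ℝ) * ω) * (z / ω)) (((η / Real.pi : ℝ) * ω) * 1)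
      (((η / Real.pi : ℝ) * ω) * 1) := by
    rw [e, mul_one]
    refine ⟨hπ, ?_, ?_, l1, l1, ?_, ?_⟩
    · rw [re_ofReal_mul]; exact mul_pos hr h.re₁
    · rw [re_ofReal_mul]; exact mul_pos hr h.re₁
    · rw [re_ofReal_mul]; exact mul_pos hr h.z_pos
    · have := h.z_lt
      simp only [Nat.cast_one, one_mul, Nat.cast_zero, zero_mul, add_zero] at this ⊢
      rw [re_ofReal_mul, re_ofReal_mul]
      exact mul_lt_mul_of_pos_left this hr
  have := lineInt_smul_congr hpi hl
  rw [e, mul_one, one_mul, mul_one, lineInt_real_smul hr,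
    div_mul_cancel₀ _ hπ.ne'] at this
  exact this.symm

/-! ### Polylogarithms -/

theorem Li_zero_left {x : ℂ} (hx : ‖x‖ < 1) : Li 0 x = x / (1 - x) := by
  simp only [Li, pow_zero, div_one, pow_succ]
  rw [tsum_mul_right, tsum_geometric_of_norm_lt_one hx]
  field_simp

theorem Li_zero_right (k : ℕ) : Li k 0 = 0 := by simp [Li]

theorem hasDerivAt_Li (k : ℕ) {x : ℂ} (hx : ‖x‖ < 1) :
    HasDerivAt (Li (k + 1)) (∑' n : ℕ, x ^ n / ((n : ℂ) + 1) ^ k) x := by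
  obtain ⟨r, hr, hr1⟩ := exists_between hx
  have hr0 : 0 < r := (norm_nonneg x).trans_lt hr
  refine hasDerivAt_tsum_of_isPreconnected (u := fun n => r ^ n)
    (g := fun (n : ℕ) (x : ℂ) => x ^ (n + 1) / ((n : ℂ) + 1) ^ (k + 1))
    (g' := fun n x => x ^ n / ((n : ℂ) + 1) ^ k) (t := Metric.ball 0 r) (y₀ := 0)
    (summable_geometric_of_lt_one hr0.le hr1) Metric.isOpen_ball
    (convex_ball (0 : ℂ) r).isPreconnected (fun n y _ => ?_) (fun n y hy => ?_) (by simpa) ?_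
    (by simpa using hr)
  · have hn : (n : ℂ) + 1 ≠ 0 := by exact_mod_cast n.succ_ne_zero
    refine ((hasDerivAt_pow (n + 1) y).div_const _).congr_deriv ?_
    push_cast
    rw [pow_succ _ k]
    field_simp
  · rw [norm_div, norm_pow, norm_pow]
    have h1 : (1 : ℝ) ≤ ‖(n : ℂ) + 1‖ ^ k := by
      refine one_le_pow₀ ?_
      rw [show (n : ℂ) + 1 = ((n + 1 : ℝ) : ℂ) by push_cast; rfl, norm_real, Real.norm_of_nonneg
        (by positivity)]
      linarith [n.cast_nonneg (α := ℝ)]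
    have h2 : ‖y‖ ^ n ≤ r ^ n := by
      have : ‖y‖ < r := by simpa using hy
      gcongr
    exact (div_le_self (by positivity) h1).trans h2
  · simp only [ne_eq, Nat.succ_ne_zero, not_false_eq_true, zero_pow, zero_div]
    exact summable_zero

/-- The chain `x (d/dx) Li_{k+1} = Li_k` in the exponential coordinate. -/
theorem hasDerivAt_Li_exp {g : ℂ → ℂ} {g' x : ℂ} (hg : HasDerivAt g g' x)
    (h : ‖exp (g x)‖ < 1) (k : ℕ) :
    HasDerivAt (fun y => Li (k + 1) (exp (g y))) (g' * Li k (exp (g x))) x := by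
  refine ((hasDerivAt_Li k h).comp x hg.cexp).congr_deriv ?_
  have : Li k (exp (g x)) = exp (g x) * ∑' n : ℕ, exp (g x) ^ n / ((n : ℂ) + 1) ^ k := by
    rw [Li, ← tsum_mul_left]
    congr 1; ext n; ring
  rw [this]; ring

/-! ### Evaluation by polylogarithms -/

theorem norm_exp_two_pi_lt_one {z ω : ℂ} (h : 0 < (z / ω).im) :
    ‖exp (2 * Real.pi * I * z / ω)‖ < 1 := by
  rw [norm_exp, Real.exp_lt_one_iff, mul_div_assoc]
  have : (2 * Real.pi * I * (z / ω)).re = -(2 * Real.pi * (z / ω).im) := by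
    rw [show (2 * Real.pi * I * (z / ω)) = ((2 * Real.pi : ℝ) : ℂ) * (I * (z / ω)) by
      push_cast; ring, re_ofReal_mul, I_mul_re]
    ring
  rw [this]
  have := Real.pi_pos
  have : 0 < 2 * Real.pi * (z / ω).im := by positivity
  linarith

theorem one_sub_exp_ne_zero {z ω : ℂ} (h0 : 0 < z.re) (h1 : z.re < ω.re) :
    1 - exp (2 * Real.pi * I * z / ω) ≠ 0 := by
  intro h
  have hω : ω ≠ 0 := by rintro rfl; simp at h1; linarith
  obtain ⟨n, hn⟩ := exp_eq_one_iff.1 (sub_eq_zero.1 h).symm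
  have : z = n * ω := by
    have h2 : (2 * Real.pi * I : ℂ) ≠ 0 := by simp
    rw [div_eq_iff hω] at hn
    exact mul_left_cancel₀ h2 (by rw [hn]; ring)
  have hre := congrArg re this
  rw [show (n : ℂ) = ((n : ℝ) : ℂ) by push_cast; rfl, re_ofReal_mul] at hre
  have hω0 : 0 < ω.re := by linarith
  have a1 : (0 : ℝ) < n := by
    rw [hre] at h0
    exact pos_of_mul_pos_left h0 hω0.le
  have a2 : (n : ℝ) < 1 := by nlinarith
  have a3 : 0 < n := by exact_mod_cast a1
  have a4 : n < 1 := by exact_mod_cast a2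
  omega

/-- The open strip `0 < Re z < Re ω`. -/
def strip (ω : ℂ) : Set ℂ := {z | 0 < z.re ∧ z.re < ω.re}

theorem isOpen_strip (ω : ℂ) : IsOpen (strip ω) :=
  (isOpen_lt continuous_const continuous_re).inter (isOpen_lt continuous_re continuous_const)

theorem convex_strip (ω : ℂ) : Convex ℝ (strip ω) :=
  (convex_halfSpace_re_gt 0).inter (convex_halfSpace_re_lt _)

theorem Adm.of_mem_strip {η : ℝ} {z z' ω : ℂ} (h : Adm 1 0 η z ω ω) (hz : z' ∈ strip ω) :
    Adm 1 0 η z' ω ω :=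
  ⟨h.η_pos, h.re₁, h.re₂, h.lt₁, h.lt₂, hz.1, by simpa using hz.2⟩

theorem Adm.mem_strip {η : ℝ} {z ω : ℂ} (h : Adm 1 0 η z ω ω) : z ∈ strip ω :=
  ⟨h.z_pos, by simpa using h.z_lt⟩

theorem half_mem_strip {ω : ℂ} (h : 0 < ω.re) (y : ℝ) : ω / 2 + y * I ∈ strip ω := by
  constructor <;> simp <;> linarith

/-- The residue formula for `∫ e ^ (z s) / (e ^ (ω s) - 1) ds`. Rotating to `ω = 1` is possible only
for `0 < Re (z / ω) < 1`, so that the formula is first shown close to `z = ω / 2`. -/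
theorem Adm.lineInt_zero {η : ℝ} {z ω : ℂ} (h : Adm 1 0 η z ω ω) :
    lineInt 1 0 0 η z ω ω = 2 * Real.pi * I / ω * (exp (2 * Real.pi * I * z / ω)
      / (1 - exp (2 * Real.pi * I * z / ω))) := by
  have hω : ω ≠ 0 := by rintro rfl; simpa using h.re₁
  have hd1 : ∀ z ∈ strip ω, HasDerivAt (fun z => lineInt 1 0 1 η z ω ω)
      (lineInt 1 0 0 η z ω ω) z := fun z hz => (h.of_mem_strip hz).hasDerivAt_z 0
  have hd0 : DifferentiableOn ℂ (fun z => lineInt 1 0 0 η z ω ω) (strip ω) := by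
    have : DifferentiableOn ℂ (fun z => lineInt 1 0 1 η z ω ω) (strip ω) :=
      fun z hz => (hd1 z hz).differentiableAt.differentiableWithinAt
    exact (this.deriv (isOpen_strip ω)).congr fun z hz => (hd1 z hz).deriv.symm
  have hg : DifferentiableOn ℂ (fun z => 2 * Real.pi * I / ω * (exp (2 * Real.pi * I * z / ω)
      / (1 - exp (2 * Real.pi * I * z / ω)))) (strip ω) := by
    refine DifferentiableOn.const_mul (DifferentiableOn.div (by fun_prop) (by fun_prop) ?_) _
    exact fun z hz => one_sub_exp_ne_zero hz.1 hz.2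
  have hmid : ω / 2 ∈ strip ω := by simpa using half_mem_strip h.re₁ 0
  refine (hd0.analyticOnNhd (isOpen_strip ω)).eqOn_of_preconnected_of_eventuallyEq
    (hg.analyticOnNhd (isOpen_strip ω)) (convex_strip ω).isPreconnected hmid ?_ h.mem_strip
  have hc : Continuous fun z : ℂ => (z / ω).re := by fun_prop
  have hhalf : (ω / 2 / ω).re = 1 / 2 := by
    rw [show ω / 2 / ω = ((1 / 2 : ℝ) : ℂ) by push_cast; field_simp, ofReal_re]
  have e0 : ∀ᶠ z in 𝓝 (ω / 2), 0 < (z / ω).re :=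
    continuousAt_const.eventually_lt hc.continuousAt (by rw [hhalf]; norm_num)
  have e1 : ∀ᶠ z in 𝓝 (ω / 2), (z / ω).re < 1 :=
    hc.continuousAt.eventually_lt continuousAt_const (by rw [hhalf]; norm_num)
  have e2 := (isOpen_strip ω).mem_nhds hmid
  have e3 : ∀ᶠ z in 𝓝 (ω / 2),
      lineInt 1 0 1 η z ω ω = lineInt 1 0 1 Real.pi (z / ω) 1 1 := by
    filter_upwards [e0, e1, e2] with z h0 h1 h2
    exact lineInt_one_one_eq (h.of_mem_strip h2) h0 h1
  filter_upwards [e0, e1, e2, e3.eventually_nhds] with z h0 h1 h2 h3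
  have hpi : Adm 1 0 Real.pi (z / ω) 1 1 := by
    have := Real.pi_pos
    exact ⟨this, by simp, by simp, by simp; linarith, by simp; linarith, h0, by simpa using h1⟩
  have d : HasDerivAt (fun z => lineInt 1 0 1 Real.pi (z / ω) 1 1)
      (lineInt 1 0 0 Real.pi (z / ω) 1 1 * (1 / ω)) z :=
    (hpi.hasDerivAt_z 0).comp (h₂ := fun z => lineInt 1 0 1 Real.pi z 1 1) z
      ((hasDerivAt_id z).div_const ω)
  have := (hd1 z h2).unique (d.congr_of_eventuallyEq h3)
  rw [this, lineInt_pi h0 h1, mul_div_assoc (2 * Real.pi * I) z ω]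
  ring

/-- Moving `z` upwards makes the integral decay, since the line of integration lies strictly
above the real axis. -/
theorem Adm.tendsto_lineInt {η : ℝ} {z ω : ℂ} (h : Adm 1 0 η z ω ω) (k : ℕ) :
    Tendsto (fun y : ℝ => lineInt 1 0 k η (ω / 2 + y * I) ω ω) atTop (𝓝 0) := by
  set A := ∫ t : ℝ, ‖kernel 1 0 k (ω / 2) ω ω (t + η * I)‖
  have hb : ∀ y : ℝ, ‖lineInt 1 0 k η (ω / 2 + y * I) ω ω‖ ≤ Real.exp (-(η * y)) * A := by
    intro y
    refine (norm_integral_le_integral_norm _).trans (le_of_eq ?_)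
    rw [← integral_const_mul]
    refine integral_congr_ae (ae_of_all _ fun t => ?_)
    simp only [kernel, add_mul (ω / 2), exp_add, norm_mul, norm_exp (y * I * (t + η * I))]
    have : (y * I * ((t : ℂ) + η * I)).re = -(η * y) := by simp; ring
    rw [this]
    ring
  have hexp : Tendsto (fun y : ℝ => Real.exp (-(η * y)) * A) atTop (𝓝 0) := by
    have := (Real.tendsto_exp_neg_atTop_nhds_zero.comp
      (tendsto_id.const_mul_atTop h.η_pos)).mul_const A
    simpa using this
  exact squeeze_zero_norm hb hexp

theorem im_half_div {ω : ℂ} (h : 0 < ω.re) (y : ℝ) :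
    ((ω / 2 + y * I) / ω).im = y * (ω.re / normSq ω) := by
  have hω : ω ≠ 0 := by rintro rfl; simp at h
  have : (ω / 2 + y * I) / ω = ((1 / 2 : ℝ) : ℂ) + y * (I * ω⁻¹) := by
    push_cast; field_simp
  rw [this, add_im, ofReal_im, im_ofReal_mul, I_mul_im, inv_re, zero_add]

theorem tendsto_exp_half {ω : ℂ} (h : 0 < ω.re) :
    Tendsto (fun y : ℝ => exp (2 * Real.pi * I * (ω / 2 + y * I) / ω)) atTop (𝓝 0) := by
  have hω : ω ≠ 0 := by rintro rfl; simp at h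
  have hc : 0 < 2 * Real.pi * (ω.re / normSq ω) := by
    have := normSq_pos.2 hω
    have := Real.pi_pos
    positivity
  refine squeeze_zero_norm' (a := fun y => Real.exp (-(2 * Real.pi * (ω.re / normSq ω) * y))) ?_
    (Real.tendsto_exp_neg_atTop_nhds_zero.comp (tendsto_id.const_mul_atTop hc))
  filter_upwards [eventually_gt_atTop 0] with y hy
  rw [norm_exp, mul_div_assoc]
  have : (2 * Real.pi * I * ((ω / 2 + y * I) / ω)).re
      = -(2 * Real.pi * ((ω / 2 + y * I) / ω).im) := by
    rw [show (2 * Real.pi * I * ((ω / 2 + y * I) / ω))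
      = ((2 * Real.pi : ℝ) : ℂ) * (I * ((ω / 2 + y * I) / ω)) by
      push_cast; ring, re_ofReal_mul, I_mul_re]
    ring
  rw [this, im_half_div h]
  apply le_of_eq; ring_nf

theorem hasDerivAt_two_pi_mul (z ω : ℂ) :
    HasDerivAt (fun z => 2 * Real.pi * I * z / ω) (2 * Real.pi * I / ω) z := by
  simpa using ((hasDerivAt_id z).const_mul (2 * Real.pi * I)).div_const ω

/-- The factor in the difference equation of `F`. Both sides have the same logarithmic derivative
in `z`, and tend to `1` as `z = ω / 2 + i y` moves up. -/
theorem Adm.exp_lineInt_one {η : ℝ} {z ω : ℂ} (h : Adm 1 0 η z ω ω) :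
    exp (lineInt 1 0 1 η z ω ω) = (1 - exp (2 * Real.pi * I * z / ω))⁻¹ := by
  set f : ℂ → ℂ := fun z =>
    exp (lineInt 1 0 1 η z ω ω) * (1 - exp (2 * Real.pi * I * z / ω)) with hf
  have hd : ∀ z ∈ strip ω, HasDerivAt f 0 z := by
    intro z hz
    have hz' := h.of_mem_strip hz
    refine (((hz'.hasDerivAt_z 0).cexp).fun_mul
      ((hasDerivAt_two_pi_mul z ω).cexp.const_sub 1)).congr_deriv ?_
    have := one_sub_exp_ne_zero hz.1 hz.2
    rw [zero_add, hz'.lineInt_zero]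
    field_simp
    ring
  have hconst : ∀ y : ℝ, f (ω / 2 + y * I) = f z := fun y =>
    (isOpen_strip ω).is_const_of_deriv_eq_zero (convex_strip ω).isPreconnected
      (fun z hz => (hd z hz).differentiableAt.differentiableWithinAt)
      (fun z hz => (hd z hz).deriv) (half_mem_strip h.re₁ y) h.mem_strip
  have hlim : Tendsto (fun y : ℝ => f (ω / 2 + y * I)) atTop (𝓝 1) := by
    have := ((continuous_exp.tendsto 0).comp (h.tendsto_lineInt 1)).mul
      ((tendsto_exp_half h.re₁).const_sub 1)
    simpa using this
  simp only [hconst] at hlim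
  exact eq_inv_of_mul_eq_one_left (tendsto_nhds_unique tendsto_const_nhds hlim)

/-- The expansion as a sum over the poles in the upper half-plane. Both sides have the same
`z`-derivative by induction, and tend to `0` as `z = ω / 2 + i y` moves up. -/
theorem Adm.lineInt_eq_Li {η : ℝ} {ω : ℂ} (k : ℕ) :
    ∀ {z : ℂ}, Adm 1 0 η z ω ω → 0 < (z / ω).im →
    lineInt 1 0 k η z ω ω = 2 * Real.pi * I / ω * (ω / (2 * Real.pi * I)) ^ k
      * Li k (exp (2 * Real.pi * I * z / ω)) := by
  induction k with
  | zero =>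
    intro z h hz
    rw [h.lineInt_zero, Li_zero_left (norm_exp_two_pi_lt_one hz)]
    ring
  | succ k ih =>
    intro z h hz
    have hω : ω ≠ 0 := by rintro rfl; simpa using h.re₁
    set f : ℂ → ℂ := fun z => lineInt 1 0 (k + 1) η z ω ω
      - 2 * Real.pi * I / ω * (ω / (2 * Real.pi * I)) ^ (k + 1)
        * Li (k + 1) (exp (2 * Real.pi * I * z / ω)) with hf
    set V : Set ℂ := strip ω ∩ {z | 0 < (z / ω).im} with hV
    have hVo : IsOpen V := (isOpen_strip ω).inter
      (isOpen_lt continuous_const (by fun_prop))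
    have hVc : Convex ℝ V := by
      refine (convex_strip ω).inter ?_
      exact convex_halfSpace_gt
        (IsLinearMap.mk (fun x y => by simp [add_div]) (fun c x => by
          simp only [real_smul, smul_eq_mul, mul_div_assoc, im_ofReal_mul])) 0
    have hd : ∀ z ∈ V, HasDerivAt f 0 z := by
      intro z hz
      have hz' := h.of_mem_strip hz.1
      refine ((hz'.hasDerivAt_z k).fun_sub ((hasDerivAt_Li_exp (hasDerivAt_two_pi_mul z ω)
        (norm_exp_two_pi_lt_one hz.2) k).const_mul _)).congr_deriv ?_
      have : (Real.pi : ℂ) ≠ 0 := by exact_mod_cast Real.pi_ne_zero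
      rw [ih hz' hz.2, pow_succ]
      field_simp
      ring
    have hmem : ∀ y : ℝ, 0 < y → ω / 2 + y * I ∈ V := by
      refine fun y hy => ⟨half_mem_strip h.re₁ y, ?_⟩
      rw [Set.mem_ofPred_eq, im_half_div h.re₁]
      exact mul_pos hy (div_pos h.re₁ (normSq_pos.2 hω))
    have hconst : ∀ y : ℝ, 0 < y → f (ω / 2 + y * I) = f z := fun y hy =>
      hVo.is_const_of_deriv_eq_zero hVc.isPreconnected
        (fun z hz => (hd z hz).differentiableAt.differentiableWithinAt)
        (fun z hz => (hd z hz).deriv) (hmem y hy) ⟨h.mem_strip, hz⟩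
    have hlim : Tendsto (fun y : ℝ => f (ω / 2 + y * I)) atTop (𝓝 0) := by
      have hL : Tendsto (Li (k + 1)) (𝓝 0) (𝓝 0) := by
        have := (hasDerivAt_Li k (x := 0) (by simp)).continuousAt.tendsto
        rwa [Li_zero_right] at this
      have := (h.tendsto_lineInt (k + 1)).sub
        ((hL.comp (tendsto_exp_half h.re₁)).const_mul
          (2 * Real.pi * I / ω * (ω / (2 * Real.pi * I)) ^ (k + 1)))
      simpa using this
    have hz0 : f z = 0 := by
      refine tendsto_nhds_unique (tendsto_const_nhds.congr' ?_) hlim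
      filter_upwards [eventually_gt_atTop 0] with y hy
      exact (hconst y hy).symm
    exact sub_eq_zero.1 hz0

/-! ### From the contour with a detour to a horizontal line -/

/-- A primitive on the disc slit along the negative imaginary axis, obtained from a primitive of
`u ↦ f (I e ^ u) I e ^ u` on the half-plane `Re u < log ρ`. -/
theorem exists_primitive_slit_disc {f : ℂ → ℂ} {ρ : ℝ} (hρ : 0 < ρ)
    (hf : ∀ s, s ≠ 0 → ‖s‖ < ρ → DifferentiableAt ℂ f s) :
    ∃ Q : ℂ → ℂ, ∀ s, ‖s‖ < ρ → s / I ∈ slitPlane → HasDerivAt Q (f s) s := by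
  have hconv : Convex ℝ {u : ℂ | u.re < Real.log ρ} := convex_halfSpace_re_lt _
  have hopen : IsOpen {u : ℂ | u.re < Real.log ρ} := isOpen_lt continuous_re continuous_const
  obtain ⟨P, hP⟩ := hconv.exists_forall_hasDerivWithinAt (𝕜 := ℂ)
    (f := fun u => f (exp u * I) * (exp u * I)) (by
      intro u hu
      refine DifferentiableAt.differentiableWithinAt ?_
      have h1 : DifferentiableAt ℂ (fun u => exp u * I) u := by fun_prop
      refine DifferentiableAt.mul (DifferentiableAt.comp u (hf _ (by simp) ?_) h1) h1
      rw [norm_mul, norm_I, mul_one, norm_exp, ← Real.exp_log hρ]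
      exact Real.exp_lt_exp.2 hu)
  refine ⟨fun s => P (log (s / I)), fun s hs hs' => ?_⟩
  have hs0 : s / I ≠ 0 := slitPlane_ne_zero hs'
  have hmem : log (s / I) ∈ {u : ℂ | u.re < Real.log ρ} := by
    simp only [Set.mem_ofPred_eq, log_re]
    refine Real.log_lt_log (norm_pos_iff.2 hs0) ?_
    simpa using hs
  have hd := (hP _ hmem).hasDerivAt (hopen.mem_nhds hmem)
  have h2 : HasDerivAt (fun s => log (s / I)) (1 / I / (s / I)) s :=
    ((hasDerivAt_id s).div_const I).clog hs'
  refine (hd.comp s h2).congr_deriv ?_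
  have hs1 : s ≠ 0 := by rintro rfl; simp at hs0
  rw [exp_log hs0, div_mul_cancel₀ _ I_ne_zero]
  field_simp

theorem integrableOn_of_exp_tail {f : ℝ → ℂ} {s : Set ℝ} {C δ T : ℝ} (hs : IsClosed s)
    (hf : ContinuousOn f s) (hδ : 0 < δ)
    (hb : ∀ t ∈ s, T ≤ |t| → ‖f t‖ ≤ C * Real.exp (-δ * |t|)) : IntegrableOn f s := by
  obtain ⟨K, hK⟩ := (isCompact_Icc.inter_left hs : IsCompact (s ∩ Set.Icc (-T) T))
    |>.exists_bound_of_continuousOn (hf.mono Set.inter_subset_left)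
  refine Integrable.mono' ((integrable_exp_neg_mul_abs hδ (|C| + |K| * Real.exp (δ * T))).integrableOn)
    (hf.aestronglyMeasurable hs.measurableSet) ?_
  refine (ae_restrict_iff' hs.measurableSet).2 (ae_of_all _ fun t ht => ?_)
  rw [add_mul]
  have e1 : 0 ≤ |C| * Real.exp (-δ * |t|) := by positivity
  have e2 : 0 ≤ |K| * Real.exp (δ * T) * Real.exp (-δ * |t|) := by positivity
  rcases le_total T |t| with h | h
  · have := hb t ht h
    have : C * Real.exp (-δ * |t|) ≤ |C| * Real.exp (-δ * |t|) := by gcongr; exact le_abs_self C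
    linarith
  · have h1 := hK t ⟨ht, abs_le.1 h⟩
    have h2 : 1 ≤ Real.exp (δ * T) * Real.exp (-δ * |t|) := by
      rw [← Real.exp_add, Real.one_le_exp_iff]
      nlinarith
    have h3 : |K| ≤ |K| * (Real.exp (δ * T) * Real.exp (-δ * |t|)) :=
      le_mul_of_one_le_right (abs_nonneg K) h2
    have := le_abs_self K
    linarith

section Contour

variable {f : ℂ → ℂ} {ε η : ℝ}

theorem tendsto_vertical {C δ T : ℝ} (hη : 0 < η) (hδ : 0 < δ)
    (hb : ∀ t y : ℝ, T ≤ |t| → 0 ≤ y → y ≤ η → ‖f (t + y * I)‖ ≤ C * Real.exp (-δ * |t|))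
    {a : ℝ → ℝ} (ha : Tendsto (fun R => |a R|) atTop atTop) :
    Tendsto (fun R => I • ∫ y in (0 : ℝ)..η, f (a R + y * I)) atTop (𝓝 0) := by
  have h1 : Tendsto (fun R => C * Real.exp (-(δ * |a R|)) * |η - 0|) atTop (𝓝 0) := by
    have := ((Real.tendsto_exp_neg_atTop_nhds_zero.comp
      (ha.const_mul_atTop hδ)).const_mul C).mul_const |η - 0|
    simpa using this
  refine squeeze_zero_norm' ?_ h1
  filter_upwards [ha.eventually_ge_atTop T] with R hR
  rw [norm_smul, norm_I, one_mul, ← neg_mul]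
  refine intervalIntegral.norm_integral_le_of_norm_le_const fun y hy => ?_
  rw [Set.uIoc_of_le hη.le] at hy
  exact hb _ _ hR hy.1.le hy.2

theorem rectangle_eq {a b : ℝ} (hη : 0 < η) (hab : a ≤ b)
    (hf : ∀ s : ℂ, a ≤ s.re → s.re ≤ b → 0 ≤ s.im → s.im ≤ η → DifferentiableAt ℂ f s) :
    (∫ x in a..b, f x) - (∫ x in a..b, f (x + η * I)) + I • (∫ y in (0 : ℝ)..η, f (b + y * I))
      - I • (∫ y in (0 : ℝ)..η, f (a + y * I)) = 0 := by
  have := integral_boundary_rect_eq_zero_of_differentiableOn f (a : ℂ) (b + η * I) (by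
    intro s hs
    rw [mem_reProdIm] at hs
    simp [Set.uIcc_of_le hab, Set.uIcc_of_le hη.le] at hs
    exact (hf s hs.1.1 hs.1.2 hs.2.1 hs.2.2).differentiableWithinAt)
  simpa using this

/-- The contour with a detour around the origin can be pushed up to a horizontal line. Over the two
half-infinite strips this is Cauchy's theorem for rectangles; close to the origin a primitive on
the disc slit along the negative imaginary axis takes care of the half-circle. -/
theorem contourIntegral_eq_line {ρ C δ T : ℝ} (hε : 0 < ε) (hη : 0 < η) (hρ : ε + η < ρ)
    (h₁ : ∀ s, s ≠ 0 → ‖s‖ < ρ → DifferentiableAt ℂ f s)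
    (h₂ : ∀ s : ℂ, s ≠ 0 → 0 ≤ s.im → s.im ≤ η → DifferentiableAt ℂ f s) (hδ : 0 < δ)
    (hb : ∀ t y : ℝ, T ≤ |t| → 0 ≤ y → y ≤ η → ‖f (t + y * I)‖ ≤ C * Real.exp (-δ * |t|)) :
    contourIntegral ε f = ∫ t : ℝ, f (t + η * I) := by
  have hre_ne {t : ℝ} (ht : t ≠ 0) : (t : ℂ) ≠ 0 := by exact_mod_cast ht
  have hcont (t y : ℝ) (hy0 : 0 ≤ y) (hyη : y ≤ η) (hne : t ≠ 0 ∨ y ≠ 0) :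
      DifferentiableAt ℂ f (t + y * I) := by
    refine h₂ _ ?_ (by simpa using hy0) (by simpa using hyη)
    intro h0
    have hr := congrArg re h0
    have hi := congrArg im h0
    simp at hr hi
    tauto
  -- integrability on the horizontal lines
  have hline : Continuous fun t : ℝ => f (t + η * I) := by
    rw [continuous_iff_continuousAt]
    intro t
    have : ContinuousAt (fun t : ℝ => (t : ℂ) + η * I) t := by fun_prop
    exact ContinuousAt.comp (f := fun t : ℝ => (t : ℂ) + η * I)
      (hcont t η hη.le le_rfl (Or.inr hη.ne')).continuousAt this
  have hreal {t : ℝ} (ht : t ≠ 0) : ContinuousAt (fun t : ℝ => f t) t := by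
    have h := (hcont t 0 le_rfl hη.le (Or.inl ht)).continuousAt
    simp only [ofReal_zero, zero_mul, add_zero] at h
    exact ContinuousAt.comp (f := fun t : ℝ => (t : ℂ)) h (by fun_prop)
  have iline : Integrable fun t : ℝ => f (t + η * I) := by
    rw [← integrableOn_univ]
    exact integrableOn_of_exp_tail isClosed_univ hline.continuousOn hδ
      fun t _ ht => hb t η ht hη.le le_rfl
  have hb0 (t : ℝ) (ht : T ≤ |t|) : ‖f t‖ ≤ C * Real.exp (-δ * |t|) := by
    simpa using hb t 0 ht le_rfl hη.le
  have iR : IntegrableOn (fun t : ℝ => f t) (Set.Ici ε) :=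
    integrableOn_of_exp_tail isClosed_Ici (fun t ht =>
      (hreal (hε.trans_le ht).ne').continuousWithinAt) hδ fun t _ ht => hb0 t ht
  have iL : IntegrableOn (fun t : ℝ => f t) (Set.Iic (-ε)) :=
    integrableOn_of_exp_tail isClosed_Iic (fun t ht =>
      (hreal (by have : t ≤ -ε := ht; linarith : t < 0).ne).continuousWithinAt) hδ
      fun t _ ht => hb0 t ht
  -- the half-infinite rectangles
  have right : (∫ t in Set.Ioi ε, f (t : ℂ)) - (∫ t in Set.Ioi ε, f ((t : ℂ) + η * I))
      - I • (∫ y in (0 : ℝ)..η, f (ε + y * I)) = 0 := by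
    have t1 := intervalIntegral_tendsto_integral_Ioi ε (iR.mono_set Set.Ioi_subset_Ici_self)
      tendsto_id
    have t2 := intervalIntegral_tendsto_integral_Ioi ε iline.integrableOn tendsto_id
    have t3 := tendsto_vertical hη hδ hb tendsto_abs_atTop_atTop
    have := ((t1.sub t2).add t3).sub_const (I • (∫ y in (0 : ℝ)..η, f (ε + y * I)))
    rw [add_zero] at this
    refine tendsto_nhds_unique (this.congr' ?_) tendsto_const_nhds
    filter_upwards [eventually_ge_atTop ε] with R hR
    refine rectangle_eq hη hR fun s hs _ h3 h4 => h₂ s ?_ h3 h4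
    rintro rfl
    simp at hs
    linarith
  have left : (∫ t in Set.Iic (-ε), f (t : ℂ)) - (∫ t in Set.Iic (-ε), f ((t : ℂ) + η * I))
      + I • (∫ y in (0 : ℝ)..η, f ((-ε : ℝ) + y * I)) = 0 := by
    have t1 := intervalIntegral_tendsto_integral_Iic (-ε) iL tendsto_neg_atTop_atBot
    have t2 := intervalIntegral_tendsto_integral_Iic (-ε) iline.integrableOn
      tendsto_neg_atTop_atBot
    have t3 := tendsto_vertical hη hδ hb (a := fun R => -R) (by
      simpa only [abs_neg] using tendsto_abs_atTop_atTop)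
    have := ((t1.sub t2).add_const (I • (∫ y in (0 : ℝ)..η, f ((-ε : ℝ) + y * I)))).sub t3
    rw [sub_zero] at this
    refine tendsto_nhds_unique (this.congr' ?_) tendsto_const_nhds
    filter_upwards [eventually_ge_atTop ε] with R hR
    refine rectangle_eq hη (neg_le_neg hR) fun s _ hs h3 h4 => h₂ s ?_ h3 h4
    rintro rfl
    simp at hs
    linarith
  -- the part close to the origin
  obtain ⟨Q, hQ⟩ := exists_primitive_slit_disc (by linarith) h₁
  have hnorm (t y : ℝ) (ht : |t| ≤ ε) (hy0 : 0 ≤ y) (hyη : y ≤ η) : ‖(t : ℂ) + y * I‖ < ρ := by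
    refine (norm_add_le _ _).trans_lt ?_
    rw [norm_mul, norm_I, mul_one, norm_real, norm_real, Real.norm_eq_abs, Real.norm_eq_abs,
      abs_of_nonneg hy0]
    linarith
  have hslit (t y : ℝ) (h : 0 < y ∨ t ≠ 0) : ((t : ℂ) + y * I) / I ∈ slitPlane := by
    rw [div_I, mem_slitPlane_iff]
    simpa using h
  have hQ' (t y : ℝ) (ht : |t| ≤ ε) (hy0 : 0 ≤ y) (hyη : y ≤ η) (h : 0 < y ∨ t ≠ 0) :
      HasDerivAt Q (f (t + y * I)) (t + y * I) := hQ _ (hnorm t y ht hy0 hyη) (hslit t y h)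
  have top : ∫ t in -ε..ε, f ((t : ℂ) + η * I) = Q (ε + η * I) - Q ((-ε : ℝ) + η * I) := by
    refine intervalIntegral.integral_eq_sub_of_hasDerivAt
      (f := fun t : ℝ => Q ((t : ℂ) + η * I)) (fun t ht => ?_)
      (hline.intervalIntegrable _ _)
    rw [Set.uIcc_of_le (by linarith)] at ht
    exact hasDerivAt_line (hQ' t η (abs_le.2 ht) hη.le le_rfl (Or.inl hη))
  have side (a : ℝ) (ha : |a| = ε) :
      I • ∫ y in (0 : ℝ)..η, f ((a : ℂ) + y * I) = Q (a + η * I) - Q a := by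
    have ha0 : a ≠ 0 := by rintro rfl; simp at ha; linarith
    have hc : ContinuousOn (fun y : ℝ => f ((a : ℂ) + y * I)) (Set.uIcc 0 η) := by
      intro y hy
      rw [Set.uIcc_of_le hη.le] at hy
      exact (ContinuousAt.comp (f := fun y : ℝ => (a : ℂ) + y * I)
        (hcont a y hy.1 hy.2 (Or.inl ha0)).continuousAt (by fun_prop)).continuousWithinAt
    rw [← intervalIntegral.integral_smul]
    have := intervalIntegral.integral_eq_sub_of_hasDerivAt (a := 0) (b := η)
      (f := fun y : ℝ => Q ((a : ℂ) + y * I)) (f' := fun y : ℝ => I • f ((a : ℂ) + y * I))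
      (fun y hy => ?_) (hc.const_smul I).intervalIntegrable
    · simpa using this
    · rw [Set.uIcc_of_le hη.le] at hy
      have h1 := hQ' a y ha.le hy.1 hy.2 (Or.inr ha0)
      have h2 : HasDerivAt (fun y : ℝ => (a : ℂ) + y * I) I y := by
        simpa using ((hasDerivAt_id y).ofReal_comp.mul_const I).const_add (a : ℂ)
      exact (h1.comp y h2).congr_deriv (mul_comm _ _)
  have arc : ∫ t in Real.pi..0, f (ε * exp (t * I)) * (ε * exp (t * I) * I)
      = Q ε - Q (-ε : ℝ) := by
    have hn (t : ℝ) : ‖(ε : ℂ) * exp (t * I)‖ = ε := by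
      rw [norm_mul, norm_exp_ofReal_mul_I, mul_one, norm_real, Real.norm_of_nonneg hε.le]
    have hne (t : ℝ) : (ε : ℂ) * exp (t * I) ≠ 0 := by
      rw [← norm_pos_iff, hn]; exact hε
    have hd (t : ℝ) : HasDerivAt (fun t : ℝ => (ε : ℂ) * exp (t * I)) (ε * exp (t * I) * I) t := by
      have := ((hasDerivAt_id t).ofReal_comp.mul_const I).cexp.const_mul (ε : ℂ)
      refine this.congr_deriv ?_
      simp [mul_assoc]
    have := intervalIntegral.integral_eq_sub_of_hasDerivAt (a := Real.pi) (b := 0)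
      (f := fun t : ℝ => Q (ε * exp (t * I)))
      (f' := fun t : ℝ => f (ε * exp (t * I)) * (ε * exp (t * I) * I)) (fun t ht => ?_) ?_
    · rw [this]
      simp
    · rw [Set.uIcc_of_ge Real.pi_pos.le] at ht
      have h1 : HasDerivAt Q (f (ε * exp (t * I))) (ε * exp (t * I)) := by
        refine hQ _ (by rw [hn]; linarith) ?_
        have e : (ε : ℂ) * exp (t * I)
            = ((ε * Real.cos t : ℝ) : ℂ) + ((ε * Real.sin t : ℝ) : ℂ) * I := by
          rw [exp_mul_I]; push_cast; ring
        rw [e]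
        refine hslit _ _ ?_
        rcases (Real.sin_nonneg_of_mem_Icc ht).eq_or_lt with h | h
        · right
          have := Real.sin_sq_add_cos_sq t
          rw [← h] at this
          have hcos : Real.cos t ≠ 0 := by intro h0; rw [h0] at this; norm_num at this
          exact mul_ne_zero hε.ne' hcos
        · left; positivity
      exact h1.comp t (hd t)
    · refine Continuous.intervalIntegrable ?_ _ _
      refine Continuous.mul ?_ (by fun_prop)
      rw [continuous_iff_continuousAt]
      intro t
      exact ContinuousAt.comp (f := fun t : ℝ => (ε : ℂ) * exp (t * I))
        (h₁ _ (hne t) (by rw [hn]; linarith)).continuousAt (by fun_prop)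
  -- assembling the pieces
  have hsplit : ∫ t : ℝ, f (t + η * I) = (∫ t in Set.Iic (-ε), f ((t : ℂ) + η * I))
      + (∫ t in -ε..ε, f ((t : ℂ) + η * I)) + ∫ t in Set.Ioi ε, f ((t : ℂ) + η * I) := by
    rw [add_assoc, intervalIntegral.integral_interval_add_Ioi iline.integrableOn
      iline.integrableOn, intervalIntegral.integral_Iic_add_Ioi iline.integrableOn
      iline.integrableOn]
  rw [contourIntegral, arc, integral_Ici_eq_integral_Ioi, hsplit, top]
  rw [side ε (abs_of_pos hε)] at right
  rw [side (-ε) (by rw [abs_neg, abs_of_pos hε])] at left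
  linear_combination left + right

end Contour

theorem exp_mul_ne_one_of_im_eq_zero {ω s : ℂ} (hω : 0 < ω.re) (hs : s ≠ 0) (h : s.im = 0) :
    exp (ω * s) ≠ 1 := by
  intro h1
  have h2 := congrArg norm h1
  rw [norm_exp, norm_one, Real.exp_eq_one_iff, mul_re, h, mul_zero, sub_zero] at h2
  rcases mul_eq_zero.1 h2 with h3 | h3
  · exact hω.ne' h3
  · exact hs (Complex.ext h3 h)

theorem exp_ne_one_of_norm_lt {u : ℂ} (hu : u ≠ 0) (h : ‖u‖ < 2 * Real.pi) : exp u ≠ 1 := by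
  intro h1
  obtain ⟨n, rfl⟩ := exp_eq_one_iff.1 h1
  have hn : n ≠ 0 := by rintro rfl; simp at hu
  have h2 : (1 : ℝ) ≤ |(n : ℝ)| := by exact_mod_cast Int.one_le_abs hn
  have hπ := Real.pi_pos
  simp [abs_of_pos hπ] at h
  nlinarith

theorem detour_pos {ω₁ ω₂ : ℂ} (h : 0 < ω₁.re) : 0 < detour ω₁ ω₂ := by
  have : 0 < ‖ω₁‖ := norm_pos_iff.2 (by rintro rfl; simp at h)
  unfold detour
  positivity

theorem Adm.contourIntegral_kernel {p q : ℕ} {η : ℝ} {z ω₁ ω₂ : ℂ} (h : Adm p q η z ω₁ ω₂)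
    (hη : η < detour ω₁ ω₂) (k : ℕ) :
    contourIntegral (detour ω₁ ω₂) (kernel p q k z ω₁ ω₂) = lineInt p q k η z ω₁ ω₂ := by
  have hε := detour_pos (ω₂ := ω₂) h.re₁
  have hn1 : 0 < ‖ω₁‖ := norm_pos_iff.2 (by rintro rfl; simpa using h.re₁)
  have hn2 : 0 < ‖ω₂‖ := norm_pos_iff.2 (by rintro rfl; simpa using h.re₂)
  have hη0 := h.η_pos
  have hπ := Real.pi_gt_three
  set N := ‖ω₁‖ + ‖ω₂‖ with hN
  have hN0 : 0 < N := by positivity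
  have hdet : detour ω₁ ω₂ = 1 / N := rfl
  have hdiff {s : ℂ} (hs : s ≠ 0) (e1 : exp (ω₁ * s) ≠ 1) (e2 : exp (ω₂ * s) ≠ 1) :
      DifferentiableAt ℂ (kernel p q k z ω₁ ω₂) s :=
    (hasDerivAt_kernel_s (sub_ne_zero.2 e1) (sub_ne_zero.2 e2) hs).differentiableAt
  have hδ1 := h.z_pos
  have hδ2 := h.z_lt
  set δ := min z.re (p * ω₁.re + q * ω₂.re - z.re)
  have hδ : 0 < δ := lt_min hδ1 (by linarith)
  set M := max ‖z‖ ‖z - p * ω₁ - q * ω₂‖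
  set T := max 1 (max ((1 + N * η) / ω₁.re) ((1 + N * η) / ω₂.re))
  refine contourIntegral_eq_line (ρ := 2 * Real.pi / N) (δ := δ) (T := T)
    (C := (1 + 2) ^ p * (1 + 2) ^ q * (1 : ℝ)⁻¹ ^ k * Real.exp (M * η)) hε hη0 ?_ ?_ ?_ hδ ?_
  · rw [hdet] at hη ⊢
    have : 2 * Real.pi / N = 2 * Real.pi * (1 / N) := by ring
    rw [this]
    have : 0 < 1 / N := by positivity
    nlinarith
  · intro s hs hsρ
    rw [lt_div_iff₀ hN0] at hsρ
    have hs0 : 0 < ‖s‖ := norm_pos_iff.2 hs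
    refine hdiff hs ?_ ?_
    · refine exp_ne_one_of_norm_lt (mul_ne_zero (norm_pos_iff.1 hn1) hs) ?_
      rw [norm_mul]; nlinarith
    · refine exp_ne_one_of_norm_lt (mul_ne_zero (norm_pos_iff.1 hn2) hs) ?_
      rw [norm_mul]; nlinarith
  · intro s hs h0 h1
    rcases h0.eq_or_lt with h0 | h0
    · exact hdiff hs (exp_mul_ne_one_of_im_eq_zero h.re₁ hs h0.symm)
        (exp_mul_ne_one_of_im_eq_zero h.re₂ hs h0.symm)
    · refine hdiff hs (exp_mul_ne_one h.re₁ h0 (lt_of_le_of_lt ?_ h.lt₁))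
        (exp_mul_ne_one h.re₂ h0 (lt_of_le_of_lt ?_ h.lt₂))
      all_goals gcongr
  · intro t y ht hy0 hyη
    have hMN (r : ℝ) (hr : 0 < r) (hrT : (1 + N * η) / r ≤ T) : (1 + N * |y|) / r ≤ |t| := by
      refine le_trans ?_ (hrT.trans ht)
      rw [abs_of_nonneg hy0]
      gcongr
    have b1 := norm_inv_exp_sub_one_le (one_le_abs_re_mul h.re₁ le_rfl
      (by rw [hN]; linarith : ‖ω₁‖ ≤ N)
      (hMN _ h.re₁ ((le_max_left _ _).trans (le_max_right _ _))))
    have b2 := norm_inv_exp_sub_one_le (one_le_abs_re_mul h.re₂ le_rfl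
      (by rw [hN]; linarith : ‖ω₂‖ ≤ N)
      (hMN _ h.re₂ ((le_max_right _ _).trans (le_max_right _ _))))
    have hs : (1 : ℝ) ≤ ‖(t : ℂ) + y * I‖ := by
      have h1 := abs_re_le_norm ((t : ℂ) + y * I)
      have h2 : 1 ≤ T := le_max_left _ _
      simp at h1
      linarith
    refine (norm_kernel_le (c := 2) (m := 1) (δ := δ) (M := M) (by norm_num) one_pos hs b1 b2
      (min_le_left _ _) (min_le_right _ _) (le_max_left _ _) (le_max_right _ _)).trans ?_
    have e1 : ((t : ℂ) + y * I).im = y := by simp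
    have e2 : ((t : ℂ) + y * I).re = t := by simp
    rw [e1, e2, abs_of_nonneg hy0]
    gcongr

/-! ### The integral representations of F and G -/

/-- The domain of the integral representations. -/
structure InStrip (z ω₁ ω₂ : ℂ) : Prop where
  re₁ : 0 < ω₁.re
  re₂ : 0 < ω₂.re
  pos : 0 < z.re
  lt : z.re < (ω₁ + ω₂).re

/-- A height which works for the given periods, and for all `z` in the strip. -/
structure IsHeight (η : ℝ) (ω₁ ω₂ : ℂ) : Prop where
  pos : 0 < η
  lt_detour : η < detour ω₁ ω₂
  lt₁ : η * ‖ω₁‖ ^ 2 < 2 * Real.pi * ω₁.re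
  lt₂ : η * ‖ω₂‖ ^ 2 < 2 * Real.pi * ω₂.re

theorem exists_isHeight {ω₁ ω₂ : ℂ} (h₁ : 0 < ω₁.re) (h₂ : 0 < ω₂.re) :
    ∃ η, IsHeight η ω₁ ω₂ := by
  have hπ := Real.pi_pos
  have e1 : ∀ᶠ η : ℝ in 𝓝[>] 0, η * ‖ω₁‖ ^ 2 < 2 * Real.pi * ω₁.re :=
    nhdsWithin_le_nhds (ContinuousAt.eventually_lt (by fun_prop) continuousAt_const
      (by rw [zero_mul]; positivity))
  have e2 : ∀ᶠ η : ℝ in 𝓝[>] 0, η * ‖ω₂‖ ^ 2 < 2 * Real.pi * ω₂.re :=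
    nhdsWithin_le_nhds (ContinuousAt.eventually_lt (by fun_prop) continuousAt_const
      (by rw [zero_mul]; positivity))
  have e3 : ∀ᶠ η : ℝ in 𝓝[>] 0, η < detour ω₁ ω₂ :=
    nhdsWithin_le_nhds (gt_mem_nhds (detour_pos h₁))
  obtain ⟨η, ⟨⟨a, b⟩, c⟩, d⟩ := (((e1.and e2).and e3).and self_mem_nhdsWithin).exists
  exact ⟨η, d, c, a, b⟩

theorem InStrip.adm {η : ℝ} {z ω₁ ω₂ : ℂ} (h : InStrip z ω₁ ω₂) (hη : IsHeight η ω₁ ω₂) :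
    Adm 1 1 η z ω₁ ω₂ :=
  ⟨hη.pos, h.re₁, h.re₂, hη.lt₁, hη.lt₂, h.pos, by simpa using h.lt⟩

theorem InStrip.eventually {x : ℂ × ℂ × ℂ} (h : InStrip x.1 x.2.1 x.2.2) :
    ∀ᶠ y : ℂ × ℂ × ℂ in 𝓝 x, InStrip y.1 y.2.1 y.2.2 := by
  have c1 : Continuous fun y : ℂ × ℂ × ℂ => y.2.1.re := by fun_prop
  have c2 : Continuous fun y : ℂ × ℂ × ℂ => y.2.2.re := by fun_prop
  have c3 : Continuous fun y : ℂ × ℂ × ℂ => y.1.re := by fun_prop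
  have c4 : Continuous fun y : ℂ × ℂ × ℂ => (y.2.1 + y.2.2).re := by fun_prop
  filter_upwards [continuousAt_const.eventually_lt c1.continuousAt h.re₁,
    continuousAt_const.eventually_lt c2.continuousAt h.re₂,
    continuousAt_const.eventually_lt c3.continuousAt h.pos,
    c3.continuousAt.eventually_lt c4.continuousAt h.lt] with y e1 e2 e3 e4
  exact ⟨e1, e2, e3, e4⟩

theorem IsHeight.eventually {η : ℝ} {x : ℂ × ℂ} (h : IsHeight η x.1 x.2) (h₁ : 0 < x.1.re) :
    ∀ᶠ y : ℂ × ℂ in 𝓝 x, IsHeight η y.1 y.2 := by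
  have c1 : Continuous fun y : ℂ × ℂ => η * ‖y.1‖ ^ 2 := by fun_prop
  have c2 : Continuous fun y : ℂ × ℂ => η * ‖y.2‖ ^ 2 := by fun_prop
  have c3 : Continuous fun y : ℂ × ℂ => 2 * Real.pi * y.1.re := by fun_prop
  have c4 : Continuous fun y : ℂ × ℂ => 2 * Real.pi * y.2.re := by fun_prop
  have c5 : ContinuousAt (fun y : ℂ × ℂ => detour y.1 y.2) x := by
    have : 0 < ‖x.1‖ := norm_pos_iff.2 (by rintro h; simp [h] at h₁)
    exact ContinuousAt.div continuousAt_const (by fun_prop) (by positivity)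
  filter_upwards [continuousAt_const.eventually_lt c5 h.lt_detour,
    c1.continuousAt.eventually_lt c3.continuousAt h.lt₁,
    c2.continuousAt.eventually_lt c4.continuousAt h.lt₂] with y e1 e2 e3
  exact ⟨h.pos, e1, e2, e3⟩

theorem InStrip.FInt_eq {η : ℝ} {z ω₁ ω₂ : ℂ} (h : InStrip z ω₁ ω₂) (hη : IsHeight η ω₁ ω₂) :
    FInt z ω₁ ω₂ = exp (lineInt 1 1 1 η z ω₁ ω₂) := by
  rw [← (h.adm hη).contourIntegral_kernel hη.lt_detour, FInt]
  congr 2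
  ext s
  simp only [kernel, pow_one, div_eq_mul_inv, mul_inv]
  ring

theorem contourIntegral_neg (ε : ℝ) (f : ℂ → ℂ) :
    contourIntegral ε (fun s => -f s) = -contourIntegral ε f := by
  simp only [contourIntegral, neg_mul, integral_neg, intervalIntegral.integral_neg]
  ring

theorem InStrip.GInt_eq {η : ℝ} {z ω₁ ω₂ : ℂ} (h : InStrip z ω₁ ω₂) (hη : IsHeight η ω₁ ω₂) :
    GInt z ω₁ ω₂ = exp (-lineInt 2 1 1 η (z + ω₁) ω₁ ω₂) := by
  rw [← (h.adm hη).add₁.contourIntegral_kernel hη.lt_detour, GInt, ← contourIntegral_neg]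
  congr 2
  ext s
  simp only [kernel, pow_one, div_eq_mul_inv, mul_inv, inv_pow]
  ring

theorem lineInt_zero_left (q k : ℕ) (η : ℝ) (z ω₁ ω₂ : ℂ) :
    lineInt 0 q k η z ω₁ ω₂ = lineInt q 0 k η z ω₂ ω₂ := by
  simp only [lineInt, kernel, pow_zero, mul_one]

theorem lineInt_add_period {p q k : ℕ} {η : ℝ} {z ω₁ ω₂ : ℂ}
    (h : Adm (p + 1) q η z ω₁ ω₂) (h' : Adm p q η z ω₁ ω₂) :
    lineInt (p + 1) q k η (z + ω₁) ω₁ ω₂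
      = lineInt (p + 1) q k η z ω₁ ω₂ + lineInt p q k η z ω₁ ω₂ := by
  simp only [lineInt]
  rw [← integral_add (h.integrable k) (h'.integrable k)]
  refine integral_congr_ae (ae_of_all _ fun t => ?_)
  have h0 := h.exp_ne₁ t
  set s : ℂ := t + η * I
  have e : exp (ω₁ * s) * (exp (ω₁ * s) - 1)⁻¹ = (exp (ω₁ * s) - 1)⁻¹ + 1 := by
    field_simp; ring
  simp only [kernel, add_mul z, exp_add, pow_succ]
  linear_combination (exp (z * s) * ((exp (ω₁ * s) - 1)⁻¹) ^ p * ((exp (ω₂ * s) - 1)⁻¹) ^ q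
    * (s⁻¹) ^ k) * e

/-- The difference equation, for points which do not leave the strip. -/
theorem FInt_add {z ω₁ ω₂ : ℂ} (h : InStrip z ω₁ ω₂) (h' : InStrip (z + ω₁) ω₁ ω₂) :
    FInt (z + ω₁) ω₁ ω₂ = FInt z ω₁ ω₂ * (1 - exp (2 * Real.pi * I * z / ω₂))⁻¹ := by
  obtain ⟨η, hη⟩ := exists_isHeight h.re₁ h.re₂
  have hz : z.re < ω₂.re := by have := h'.lt; simp at this; linarith
  have h0 : Adm 0 1 η z ω₁ ω₂ :=
    ⟨hη.pos, h.re₁, h.re₂, hη.lt₁, hη.lt₂, h.pos, by simpa using hz⟩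
  have h1 : Adm 1 0 η z ω₂ ω₂ :=
    ⟨hη.pos, h.re₂, h.re₂, hη.lt₂, hη.lt₂, h.pos, by simpa using hz⟩
  rw [h.FInt_eq hη, h'.FInt_eq hη, lineInt_add_period (h.adm hη) h0, exp_add,
    lineInt_zero_left, h1.exp_lineInt_one]

theorem GInt_add {z ω₁ ω₂ : ℂ} (h : InStrip z ω₁ ω₂) (h' : InStrip (z + ω₁) ω₁ ω₂) :
    GInt (z + ω₁) ω₁ ω₂ = GInt z ω₁ ω₂ * (FInt (z + ω₁) ω₁ ω₂)⁻¹ := by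
  obtain ⟨η, hη⟩ := exists_isHeight h.re₁ h.re₂
  rw [h.GInt_eq hη, h'.GInt_eq hη, h'.FInt_eq hη,
    lineInt_add_period (h.adm hη).add₁ (h'.adm hη), neg_add, exp_add, exp_neg (lineInt 1 1 1 _ _ _ _)]

theorem IsHeight.eventually_smul {η : ℝ} {ω₁ ω₂ l : ℂ} (h : IsHeight η (l * ω₁) (l * ω₂))
    (h₁ : 0 < (l * ω₁).re) : ∀ᶠ m in 𝓝 l, IsHeight η (m * ω₁) (m * ω₂) := by
  have hc : ContinuousAt (fun m : ℂ => (m * ω₁, m * ω₂)) l := by fun_prop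
  exact hc.eventually (IsHeight.eventually (x := (l * ω₁, l * ω₂)) h h₁)

theorem InStrip.eventually_smul {z ω₁ ω₂ l : ℂ} (h : InStrip (l * z) (l * ω₁) (l * ω₂)) :
    ∀ᶠ m in 𝓝 l, InStrip (m * z) (m * ω₁) (m * ω₂) := by
  have hc : ContinuousAt (fun m : ℂ => (m * z, m * ω₁, m * ω₂)) l := by fun_prop
  exact hc.eventually (InStrip.eventually (x := (l * z, l * ω₁, l * ω₂)) h)

theorem InStrip.eventually_FInt_smul {z ω₁ ω₂ l : ℂ} (h : InStrip (l * z) (l * ω₁) (l * ω₂)) :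
    ∀ᶠ m in 𝓝 l, FInt (m * z) (m * ω₁) (m * ω₂) = FInt (l * z) (l * ω₁) (l * ω₂) := by
  obtain ⟨η, hη⟩ := exists_isHeight h.re₁ h.re₂
  filter_upwards [hη.eventually_smul h.re₁, h.eventually_smul] with m h1 h2
  rw [h.FInt_eq hη, h2.FInt_eq h1, lineInt_smul_congr (h2.adm h1) (h.adm hη)]

theorem InStrip.eventually_GInt_smul {z ω₁ ω₂ l : ℂ} (h : InStrip (l * z) (l * ω₁) (l * ω₂)) :
    ∀ᶠ m in 𝓝 l, GInt (m * z) (m * ω₁) (m * ω₂) = GInt (l * z) (l * ω₁) (l * ω₂) := by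
  obtain ⟨η, hη⟩ := exists_isHeight h.re₁ h.re₂
  filter_upwards [hη.eventually_smul h.re₁, h.eventually_smul] with m h1 h2
  have a1 := (h2.adm h1).add₁
  have a2 := (h.adm hη).add₁
  rw [← mul_add] at a1 a2
  rw [h.GInt_eq hη, h2.GInt_eq h1, ← mul_add, ← mul_add, lineInt_smul_congr a1 a2]

theorem InStrip.continuousAt_FInt {x : ℂ × ℂ × ℂ} (h : InStrip x.1 x.2.1 x.2.2) :
    ContinuousAt (fun y : ℂ × ℂ × ℂ => FInt y.1 y.2.1 y.2.2) x := by
  obtain ⟨η, hη⟩ := exists_isHeight h.re₁ h.re₂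
  refine ((h.adm hη).continuousAt 1).cexp.congr ?_
  filter_upwards [h.eventually, continuous_snd.continuousAt.eventually
    (IsHeight.eventually (x := x.2) hη h.re₁)] with y h1 h2
  exact (h1.FInt_eq h2).symm

theorem InStrip.continuousAt_GInt {x : ℂ × ℂ × ℂ} (h : InStrip x.1 x.2.1 x.2.2) :
    ContinuousAt (fun y : ℂ × ℂ × ℂ => GInt y.1 y.2.1 y.2.2) x := by
  obtain ⟨η, hη⟩ := exists_isHeight h.re₁ h.re₂
  have hc : ContinuousAt (fun y : ℂ × ℂ × ℂ => (y.1 + y.2.1, y.2.1, y.2.2)) x := by fun_prop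
  have := ContinuousAt.comp (f := fun y : ℂ × ℂ × ℂ => (y.1 + y.2.1, y.2.1, y.2.2)) (x := x)
    (Adm.continuousAt (x := (x.1 + x.2.1, x.2.1, x.2.2)) (h.adm hη).add₁ 1) hc
  refine (this.neg.cexp).congr ?_
  filter_upwards [h.eventually, continuous_snd.continuousAt.eventually
    (IsHeight.eventually (x := x.2) hη h.re₁)] with y h1 h2
  exact (h1.GInt_eq h2).symm

/-! ### The continuations of F and G -/

/-- The factor picked up by the difference equation `f (z + ω₁) = f z / u 0` after `n` steps,
where `u j` is the factor at `z + j ω₁`. -/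
noncomputable def shiftProd (u : ℤ → ℂ) (n : ℤ) : ℂ :=
  (∏ k ∈ Finset.range n.toNat, (u (-(k + 1)))⁻¹) * ∏ k ∈ Finset.range (-n).toNat, u k

theorem shiftProd_eq_succ {u : ℤ → ℂ} {n : ℤ} (h : u (-(n + 1)) ≠ 0) :
    shiftProd u n = u (-(n + 1)) * shiftProd u (n + 1) := by
  rcases le_or_gt 0 n with hn | hn
  · obtain ⟨m, rfl⟩ := Int.eq_ofNat_of_zero_le hn
    have e1 : (-(m : ℤ)).toNat = 0 := by omega
    have e2 : (-((m : ℤ) + 1)).toNat = 0 := by omega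
    have e3 : ((m : ℤ) + 1).toNat = m + 1 := by omega
    simp only [shiftProd, e1, e2, e3, Int.toNat_natCast, Finset.prod_range_succ,
      Finset.range_zero, Finset.prod_empty, mul_one]
    field_simp
  · obtain ⟨m, hm⟩ := Int.eq_ofNat_of_zero_le (by omega : 0 ≤ -(n + 1))
    have e1 : (-n).toNat = m + 1 := by omega
    have e2 : (-(n + 1)).toNat = m := by omega
    have e3 : (n + 1).toNat = 0 := by omega
    have e4 : n.toNat = 0 := by omega
    simp only [shiftProd, e1, e2, e3, e4, Finset.prod_range_succ, Finset.range_zero,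
      Finset.prod_empty, one_mul]
    rw [hm, mul_comm]

theorem shiftProd_ne_zero {u : ℤ → ℂ} (h : ∀ j, u j ≠ 0) (n : ℤ) : shiftProd u n ≠ 0 :=
  mul_ne_zero (Finset.prod_ne_zero_iff.2 fun _ _ => inv_ne_zero (h _))
    (Finset.prod_ne_zero_iff.2 fun _ _ => h _)

theorem continuousAt_shiftProd {X : Type*} [TopologicalSpace X] {u : X → ℤ → ℂ} {x : X}
    (hc : ∀ j, ContinuousAt (fun y => u y j) x) (h : ∀ j, u x j ≠ 0) (n : ℤ) :
    ContinuousAt (fun y => shiftProd (u y) n) x := by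
  unfold shiftProd
  exact (tendsto_finsetProd _ fun i _ => (hc _).inv₀ (h _)).mul
    (tendsto_finsetProd _ fun i _ => hc _)

/-- If `f (z - n ω₁)` satisfies the difference equation as long as the argument stays in the
strip, then continuing `f` from any point of the strip gives the same value. -/
theorem shift_unique {f : ℤ → ℂ} {u : ℤ → ℂ} {z ω₁ ω₂ : ℂ}
    (hu : ∀ n : ℤ, InStrip (z - n * ω₁) ω₁ ω₂ → InStrip (z - (n + 1 : ℤ) * ω₁) ω₁ ω₂ →
      u (-(n + 1)) ≠ 0 ∧ f n * u (-(n + 1)) = f (n + 1))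
    {m n : ℤ} (hm : InStrip (z - m * ω₁) ω₁ ω₂) (hn : InStrip (z - n * ω₁) ω₁ ω₂) :
    f m * shiftProd u m = f n * shiftProd u n := by
  wlog hmn : m ≤ n generalizing m n
  · exact (this hn hm (le_of_not_ge hmn)).symm
  obtain ⟨k, rfl⟩ := Int.le.dest hmn
  clear hmn
  induction k with
  | zero => simp
  | succ k ih =>
    have e (j : ℤ) : (z - j * ω₁).re = z.re - j * ω₁.re := by
      rw [sub_re, ← ofReal_intCast, re_ofReal_mul]
    have hk : InStrip (z - (m + k : ℤ) * ω₁) ω₁ ω₂ := by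
      have h1 := hm.lt
      have h2 := hn.pos
      have h3 := hm.re₁
      rw [e] at h1 h2
      refine ⟨hm.re₁, hm.re₂, ?_, ?_⟩
      · rw [e]; push_cast at h2 ⊢; linarith
      · rw [e]
        push_cast
        have : (0 : ℝ) ≤ k * ω₁.re := by positivity
        linarith
    rw [ih hk]
    have hcast : m + ((k + 1 : ℕ) : ℤ) = m + k + 1 := by push_cast; ring
    rw [hcast] at hn ⊢
    obtain ⟨h1, h2⟩ := hu (m + k) hk hn
    rw [shiftProd_eq_succ h1, ← h2]
    ring

theorem inStrip_shift {z ω₁ ω₂ : ℂ} (h₁ : 0 < ω₁.re) (h₂ : 0 < ω₂.re) :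
    InStrip (z - shift z ω₁ ω₂ * ω₁) ω₁ ω₂ := by
  unfold shift
  split_ifs with h
  · simpa using ⟨h₁, h₂, h.1, h.2⟩
  · have e (j : ℤ) : (z - j * ω₁).re = z.re - j * ω₁.re := by
      rw [sub_re, ← ofReal_intCast, re_ofReal_mul]
    have hlt := Int.ceil_lt_add_one (z.re / ω₁.re)
    have hle := Int.le_ceil (z.re / ω₁.re)
    rw [div_le_iff₀ h₁] at hle
    rw [← sub_lt_iff_lt_add, lt_div_iff₀ h₁] at hlt
    refine ⟨h₁, h₂, ?_, ?_⟩
    · rw [e]; push_cast; linarith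
    · rw [e, add_re]; push_cast; linarith

/-- The factors in the difference equation of `F`. -/
noncomputable def factorF (z ω₁ ω₂ : ℂ) (j : ℤ) : ℂ :=
  1 - exp (2 * Real.pi * I * (z + j * ω₁) / ω₂)

/-- The factors in the difference equation of `G`. -/
noncomputable def factorG (z ω₁ ω₂ : ℂ) (j : ℤ) : ℂ :=
  FHalf (z + (j + 1) * ω₁) ω₁ ω₂

theorem shift_eq_zero {z ω₁ ω₂ : ℂ} (h : InStrip z ω₁ ω₂) : shift z ω₁ ω₂ = 0 :=
  if_pos ⟨h.pos, h.lt⟩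

theorem FHalf_eq_shiftProd (z ω₁ ω₂ : ℂ) : FHalf z ω₁ ω₂
    = FInt (z - shift z ω₁ ω₂ * ω₁) ω₁ ω₂ * shiftProd (factorF z ω₁ ω₂) (shift z ω₁ ω₂) := by
  simp only [FHalf, shiftProd, factorF, mul_assoc]
  push_cast
  simp only [neg_mul, ← sub_eq_add_neg]

theorem GHalf_eq_shiftProd (z ω₁ ω₂ : ℂ) : GHalf z ω₁ ω₂
    = GInt (z - shift z ω₁ ω₂ * ω₁) ω₁ ω₂ * shiftProd (factorG z ω₁ ω₂) (shift z ω₁ ω₂) := by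
  have e (k : ℕ) : z + ((-((k : ℂ) + 1)) + 1) * ω₁ = z - k * ω₁ := by ring
  simp only [GHalf, shiftProd, factorG, mul_assoc]
  push_cast
  simp only [e]

theorem InStrip.FHalf_eq {z ω₁ ω₂ : ℂ} (h : InStrip z ω₁ ω₂) :
    FHalf z ω₁ ω₂ = FInt z ω₁ ω₂ := by
  simp [FHalf, shift_eq_zero h]

theorem InStrip.GHalf_eq {z ω₁ ω₂ : ℂ} (h : InStrip z ω₁ ω₂) :
    GHalf z ω₁ ω₂ = GInt z ω₁ ω₂ := by
  simp [GHalf, shift_eq_zero h]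

theorem FInt_ne_zero (z ω₁ ω₂ : ℂ) : FInt z ω₁ ω₂ ≠ 0 := exp_ne_zero _

theorem sub_succ_mul_add (z ω : ℂ) (n : ℤ) : z - (n + 1 : ℤ) * ω + ω = z - n * ω := by
  push_cast; ring

/-- `F` can be computed by continuation from any point `z - n ω₁` of the strip. -/
theorem FHalf_eq_of_inStrip {z ω₁ ω₂ : ℂ} {n : ℤ} (h : InStrip (z - n * ω₁) ω₁ ω₂) :
    FHalf z ω₁ ω₂ = FInt (z - n * ω₁) ω₁ ω₂ * shiftProd (factorF z ω₁ ω₂) n := by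
  rw [FHalf_eq_shiftProd]
  refine shift_unique (f := fun n => FInt (z - n * ω₁) ω₁ ω₂) (ω₁ := ω₁) (ω₂ := ω₂) ?_
    (inStrip_shift h.re₁ h.re₂) h
  intro n h0 h1
  have hF := FInt_add h1 (by rw [sub_succ_mul_add]; exact h0)
  have hu : 1 - exp (2 * Real.pi * I * (z - (n + 1 : ℤ) * ω₁) / ω₂) ≠ 0 := by
    refine one_sub_exp_ne_zero h1.pos ?_
    have h2 := h0.lt
    rw [← sub_succ_mul_add, add_re, add_re] at h2
    linarith
  have e : factorF z ω₁ ω₂ (-(n + 1)) = 1 - exp (2 * Real.pi * I * (z - (n + 1 : ℤ) * ω₁) / ω₂) := by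
    rw [factorF]; push_cast; ring_nf
  rw [e]
  refine ⟨hu, ?_⟩
  rw [sub_succ_mul_add] at hF
  rw [hF, inv_mul_cancel_right₀ hu]

theorem GHalf_eq_of_inStrip {z ω₁ ω₂ : ℂ} {n : ℤ} (h : InStrip (z - n * ω₁) ω₁ ω₂) :
    GHalf z ω₁ ω₂ = GInt (z - n * ω₁) ω₁ ω₂ * shiftProd (factorG z ω₁ ω₂) n := by
  rw [GHalf_eq_shiftProd]
  refine shift_unique (f := fun n => GInt (z - n * ω₁) ω₁ ω₂) (ω₁ := ω₁) (ω₂ := ω₂) ?_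
    (inStrip_shift h.re₁ h.re₂) h
  intro n h0 h1
  have hG := GInt_add h1 (by rw [sub_succ_mul_add]; exact h0)
  have e : factorG z ω₁ ω₂ (-(n + 1)) = FInt (z - n * ω₁) ω₁ ω₂ := by
    rw [factorG, ← h0.FHalf_eq]
    congr 1
    push_cast; ring
  rw [e]
  refine ⟨FInt_ne_zero _ _ _, ?_⟩
  rw [sub_succ_mul_add] at hG
  rw [hG, inv_mul_cancel_right₀ (FInt_ne_zero _ _ _)]

/-- The scaling factors which keep both periods in the right half-plane form a convex set, so that
local constancy on it is constancy. -/
theorem eq_of_locally_const {ω₁ ω₂ : ℂ} {f : ℂ → ℂ}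
    (hf : ∀ l : ℂ, 0 < (l * ω₁).re → 0 < (l * ω₂).re → ∀ᶠ m in 𝓝 l, f m = f l)
    {l m : ℂ} (hl₁ : 0 < (l * ω₁).re) (hl₂ : 0 < (l * ω₂).re) (hm₁ : 0 < (m * ω₁).re)
    (hm₂ : 0 < (m * ω₂).re) : f l = f m := by
  have hconv (ω : ℂ) : Convex ℝ {l : ℂ | 0 < (l * ω).re} :=
    convex_halfSpace_gt (IsLinearMap.mk (fun x y => by rw [add_mul, add_re])
      (fun c x => by rw [real_smul, mul_assoc, re_ofReal_mul, smul_eq_mul])) 0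
  have hopen (ω : ℂ) : IsOpen {l : ℂ | 0 < (l * ω).re} :=
    isOpen_lt continuous_const (by fun_prop)
  have hd (x : ℂ) (hx : x ∈ {l : ℂ | 0 < (l * ω₁).re} ∩ {l : ℂ | 0 < (l * ω₂).re}) :
      HasDerivAt f 0 x :=
    (hasDerivAt_const x (f x)).congr_of_eventuallyEq (hf x hx.1 hx.2)
  exact ((hopen ω₁).inter (hopen ω₂)).is_const_of_deriv_eq_zero
    ((hconv ω₁).inter (hconv ω₂)).isPreconnected
    (fun x hx => (hd x hx).differentiableAt.differentiableWithinAt)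
    (fun x hx => (hd x hx).deriv) ⟨hl₁, hl₂⟩ ⟨hm₁, hm₂⟩

theorem ne_zero_of_re_mul_pos {l ω : ℂ} (h : 0 < (l * ω).re) : l ≠ 0 := by
  rintro rfl
  simp at h

theorem factorF_smul {l : ℂ} (hl : l ≠ 0) (z ω₁ ω₂ : ℂ) :
    factorF (l * z) (l * ω₁) (l * ω₂) = factorF z ω₁ ω₂ := by
  ext j
  have : 2 * Real.pi * I * (l * z + j * (l * ω₁)) / (l * ω₂)
      = 2 * Real.pi * I * (z + j * ω₁) / ω₂ := by
    rw [show 2 * Real.pi * I * (l * z + j * (l * ω₁))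
      = l * (2 * Real.pi * I * (z + j * ω₁)) by ring, mul_div_mul_left _ _ hl]
  rw [factorF, factorF, this]

/-- Invariance under rescaling. For nearby scaling factors the same shift leads into the strip, so
that the invariance of the integral applies; different shifts are never compared at once. -/
theorem FHalf_smul {l z ω₁ ω₂ : ℂ} (h₁ : 0 < ω₁.re) (h₂ : 0 < ω₂.re) (hl₁ : 0 < (l * ω₁).re)
    (hl₂ : 0 < (l * ω₂).re) : FHalf (l * z) (l * ω₁) (l * ω₂) = FHalf z ω₁ ω₂ := by
  have := eq_of_locally_const (ω₁ := ω₁) (ω₂ := ω₂) (l := l) (m := 1)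
    (f := fun l => FHalf (l * z) (l * ω₁) (l * ω₂)) ?_ hl₁ hl₂ (by simpa) (by simpa)
  · simpa using this
  intro l h₁ h₂
  have h := inStrip_shift (z := l * z) h₁ h₂
  set n := shift (l * z) (l * ω₁) (l * ω₂)
  have e (m : ℂ) : m * z - n * (m * ω₁) = m * (z - n * ω₁) := by ring
  have h' := h
  rw [e] at h'
  filter_upwards [h'.eventually_smul, h'.eventually_FInt_smul] with m hm hF
  rw [FHalf_eq_of_inStrip (n := n) (by rw [e]; exact hm), FHalf_eq_of_inStrip h, e, e, hF,
    factorF_smul (ne_zero_of_re_mul_pos hm.re₁), factorF_smul (ne_zero_of_re_mul_pos h₁)]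

theorem GHalf_smul {l z ω₁ ω₂ : ℂ} (h₁ : 0 < ω₁.re) (h₂ : 0 < ω₂.re) (hl₁ : 0 < (l * ω₁).re)
    (hl₂ : 0 < (l * ω₂).re) : GHalf (l * z) (l * ω₁) (l * ω₂) = GHalf z ω₁ ω₂ := by
  have := eq_of_locally_const (ω₁ := ω₁) (ω₂ := ω₂) (l := l) (m := 1)
    (f := fun l => GHalf (l * z) (l * ω₁) (l * ω₂)) ?_ hl₁ hl₂ (by simpa) (by simpa)
  · simpa using this
  have hfac (m : ℂ) (hm₁ : 0 < (m * ω₁).re) (hm₂ : 0 < (m * ω₂).re) :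
      factorG (m * z) (m * ω₁) (m * ω₂) = factorG z ω₁ ω₂ := by
    ext j
    rw [factorG, factorG, ← FHalf_smul h₁ h₂ hm₁ hm₂]
    congr 1; ring
  intro l h₁ h₂
  have h := inStrip_shift (z := l * z) h₁ h₂
  set n := shift (l * z) (l * ω₁) (l * ω₂)
  have e (m : ℂ) : m * z - n * (m * ω₁) = m * (z - n * ω₁) := by ring
  have h' := h
  rw [e] at h'
  filter_upwards [h'.eventually_smul, h'.eventually_GInt_smul] with m hm hF
  rw [GHalf_eq_of_inStrip (n := n) (by rw [e]; exact hm), GHalf_eq_of_inStrip h, e, e, hF,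
    hfac m hm.re₁ hm.re₂, hfac l h₁ h₂]

theorem factorF_ne_zero {z ω₁ ω₂ : ℂ} (h₂ : ω₂ ≠ 0) (hz : ∀ a b : ℤ, z ≠ a * ω₁ + b * ω₂)
    (j : ℤ) : factorF z ω₁ ω₂ j ≠ 0 := by
  intro h
  obtain ⟨n, hn⟩ := exp_eq_one_iff.1 (sub_eq_zero.1 h).symm
  refine hz (-j) n ?_
  have h2 : (2 * Real.pi * I : ℂ) ≠ 0 := by simp
  rw [div_eq_iff h₂] at hn
  have := mul_left_cancel₀ h2 (hn.trans (by ring : _ = 2 * Real.pi * I * (n * ω₂)))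
  push_cast
  linear_combination this

theorem FHalf_ne_zero {z ω₁ ω₂ : ℂ} (h₂ : ω₂ ≠ 0) (hz : ∀ a b : ℤ, z ≠ a * ω₁ + b * ω₂) :
    FHalf z ω₁ ω₂ ≠ 0 := by
  rw [FHalf_eq_shiftProd]
  exact mul_ne_zero (FInt_ne_zero _ _ _) (shiftProd_ne_zero (factorF_ne_zero h₂ hz) _)

theorem continuousAt_FHalf {x : ℂ × ℂ × ℂ} (h₁ : 0 < x.2.1.re) (h₂ : 0 < x.2.2.re)
    (hz : ∀ a b : ℤ, x.1 ≠ a * x.2.1 + b * x.2.2) :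
    ContinuousAt (fun y : ℂ × ℂ × ℂ => FHalf y.1 y.2.1 y.2.2) x := by
  have h := inStrip_shift (z := x.1) h₁ h₂
  have hω₂ : x.2.2 ≠ 0 := by intro h0; simp [h0] at h₂
  set n := shift x.1 x.2.1 x.2.2
  have hc : ContinuousAt (fun y : ℂ × ℂ × ℂ => (y.1 - n * y.2.1, y.2.1, y.2.2)) x := by fun_prop
  have h1 := ContinuousAt.comp (f := fun y : ℂ × ℂ × ℂ => (y.1 - n * y.2.1, y.2.1, y.2.2))
    (InStrip.continuousAt_FInt (x := (x.1 - n * x.2.1, x.2.1, x.2.2)) h) hc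
  have h2 := continuousAt_shiftProd (x := x)
    (u := fun y : ℂ × ℂ × ℂ => factorF y.1 y.2.1 y.2.2) (fun j => by
      unfold factorF
      have hj : ContinuousAt
          (fun y : ℂ × ℂ × ℂ => 2 * Real.pi * I * (y.1 + j * y.2.1) / y.2.2) x :=
        ContinuousAt.div (by fun_prop) (by fun_prop) hω₂
      exact continuousAt_const.sub hj.cexp)
    (factorF_ne_zero hω₂ hz) n
  refine (h1.mul h2).congr ?_
  filter_upwards [hc.eventually (InStrip.eventually
    (x := (x.1 - n * x.2.1, x.2.1, x.2.2)) h)] with y hy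
  exact (FHalf_eq_of_inStrip hy).symm

theorem continuousAt_GHalf {x : ℂ × ℂ × ℂ} (h₁ : 0 < x.2.1.re) (h₂ : 0 < x.2.2.re)
    (hz : ∀ a b : ℤ, x.1 ≠ a * x.2.1 + b * x.2.2) :
    ContinuousAt (fun y : ℂ × ℂ × ℂ => GHalf y.1 y.2.1 y.2.2) x := by
  have h := inStrip_shift (z := x.1) h₁ h₂
  have hω₂ : x.2.2 ≠ 0 := by intro h0; simp [h0] at h₂
  have hz' (j : ℤ) (a b : ℤ) : x.1 + (j + 1) * x.2.1 ≠ a * x.2.1 + b * x.2.2 := by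
    intro h0
    refine hz (a - (j + 1)) b ?_
    push_cast
    linear_combination h0
  set n := shift x.1 x.2.1 x.2.2
  have hc : ContinuousAt (fun y : ℂ × ℂ × ℂ => (y.1 - n * y.2.1, y.2.1, y.2.2)) x := by fun_prop
  have h1 := ContinuousAt.comp (f := fun y : ℂ × ℂ × ℂ => (y.1 - n * y.2.1, y.2.1, y.2.2))
    (InStrip.continuousAt_GInt (x := (x.1 - n * x.2.1, x.2.1, x.2.2)) h) hc
  have h2 := continuousAt_shiftProd (x := x)
    (u := fun y : ℂ × ℂ × ℂ => factorG y.1 y.2.1 y.2.2) (fun j => by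
      have hcj : ContinuousAt (fun y : ℂ × ℂ × ℂ => (y.1 + (j + 1) * y.2.1, y.2.1, y.2.2)) x := by
        fun_prop
      exact ContinuousAt.comp (f := fun y : ℂ × ℂ × ℂ => (y.1 + (j + 1) * y.2.1, y.2.1, y.2.2))
        (continuousAt_FHalf (x := (x.1 + (j + 1) * x.2.1, x.2.1, x.2.2)) h₁ h₂ (hz' j)) hcj)
    (fun j => FHalf_ne_zero hω₂ (hz' j)) n
  refine (h1.mul h2).congr ?_
  filter_upwards [hc.eventually (InStrip.eventually
    (x := (x.1 - n * x.2.1, x.2.1, x.2.2)) h)] with y hy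
  exact (GHalf_eq_of_inStrip hy).symm

/-! ### Asymptotics for a small period -/

/-- The remainder of the expansion `1 / (e ^ u - 1) = 1 / u - 1 / 2 + O(u)`. -/
noncomputable def toddRem (u : ℂ) : ℂ := (exp u - 1)⁻¹ - u⁻¹ + 1 / 2

theorem norm_toddRem_le_of_small {u : ℂ} (hu : u ≠ 0) (h : ‖u‖ ≤ 1 / 2) :
    ‖toddRem u‖ ≤ 2 * ‖u‖ := by
  have hu0 : 0 < ‖u‖ := norm_pos_iff.2 hu
  have h1 : ‖u‖ ≤ 1 := by linarith
  set r := exp u - 1 - u - u ^ 2 / 2 with hr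
  have hrb : ‖r‖ ≤ ‖u‖ ^ 3 / 4 := by
    have := exp_bound h1 (n := 3) (by norm_num)
    simp only [Finset.sum_range_succ, Finset.sum_range_zero, Nat.factorial] at this
    norm_num at this
    have e : exp u - (1 + u + u ^ 2 / 2) = r := by rw [hr]; ring
    rw [e] at this
    have : 0 ≤ ‖u‖ ^ 3 := by positivity
    linarith
  have hE : ‖u‖ / 2 ≤ ‖exp u - 1‖ := by
    have h2 := norm_exp_sub_one_sub_id_le h1
    have h3 := norm_sub_norm_le u (u - (exp u - 1))
    rw [sub_sub_cancel, norm_sub_rev] at h3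
    nlinarith
  have hE0 : exp u - 1 ≠ 0 := norm_pos_iff.1 (by linarith)
  have e : toddRem u = (-2 * r + u ^ 3 / 2 + u * r) / (2 * u * (exp u - 1)) := by
    rw [toddRem, hr]
    field_simp
    ring
  rw [e, norm_div, div_le_iff₀ (norm_pos_iff.2 (by simp [hu, hE0]))]
  have hn : ‖-2 * r + u ^ 3 / 2 + u * r‖ ≤ 2 * ‖u‖ ^ 3 := by
    refine (norm_add₃_le).trans ?_
    rw [norm_mul, norm_div, norm_mul, norm_pow]
    norm_num
    nlinarith [norm_nonneg r, pow_pos hu0 3]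
  refine hn.trans ?_
  rw [norm_mul, norm_mul]
  norm_num
  nlinarith [mul_pos hu0 hu0]

/-- On the line `Im s = η` the linear bound for the remainder is uniform for `ω` in a sector, for all
`s`: where `ω s` is not small, `Re (ω s)` is bounded away from `0`. -/
theorem norm_toddRem_le {c η : ℝ} {ω : ℂ} (hc : 0 < c) (hη : 0 < η) (hω : ω ≠ 0)
    (hcω : c * ‖ω‖ ≤ ω.re) (hs : η * ‖ω‖ ≤ c / 8) (t : ℝ) :
    ‖toddRem (ω * (t + η * I))‖
      ≤ (2 * (1 - Real.exp (-(c / 4)))⁻¹ + 5) * ‖ω * (t + η * I)‖ := by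
  set u := ω * (t + η * I) with hu
  have hω0 : 0 < ‖ω‖ := norm_pos_iff.2 hω
  have hc1 : c ≤ 1 := by
    have := (hcω.trans (re_le_norm ω))
    exact le_of_mul_le_mul_right (by linarith) hω0
  have hκ : 0 < (1 - Real.exp (-(c / 4)))⁻¹ := by
    have : Real.exp (-(c / 4)) < 1 := Real.exp_lt_one_iff.2 (by linarith)
    exact inv_pos.2 (by linarith)
  rcases le_or_gt ‖u‖ (1 / 2) with h | h
  · refine (norm_toddRem_le_of_small (mul_ne_zero hω (line_ne_zero hη t)) h).trans ?_
    have := norm_nonneg u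
    nlinarith
  · have hnu : ‖u‖ ≤ ‖ω‖ * (|t| + η) := by
      rw [hu, norm_mul]
      gcongr
      refine (norm_add_le _ _).trans (le_of_eq ?_)
      simp [abs_of_pos hη]
    have hre : c / 4 ≤ |u.re| := by
      have e : u.re = ω.re * t - ω.im * η := by simp [hu]
      have h1 : |ω.im * η| ≤ ‖ω‖ * η := by
        rw [abs_mul, abs_of_pos hη]
        exact mul_le_mul_of_nonneg_right (abs_im_le_norm ω) hη.le
      have h2 : c * ‖ω‖ * |t| ≤ |ω.re * t| := by
        rw [abs_mul]
        exact mul_le_mul_of_nonneg_right (hcω.trans (le_abs_self _)) (abs_nonneg _)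
      have h3 := abs_sub_abs_le_abs_sub (ω.re * t) (ω.im * η)
      rw [e]
      have h4 : 3 / 8 ≤ ‖ω‖ * |t| := by nlinarith
      nlinarith
    have hb := norm_inv_exp_sub_one_le_of_abs_re (by positivity) hre
    have hu1 : ‖u⁻¹‖ ≤ 2 := by
      rw [norm_inv, inv_le_comm₀ (by linarith) (by norm_num)]
      linarith
    have : ‖toddRem u‖ ≤ (1 - Real.exp (-(c / 4)))⁻¹ + 2 + 1 / 2 := by
      refine (norm_add_le _ _).trans (add_le_add ((norm_sub_le _ _).trans
        (add_le_add hb hu1)) ?_)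
      norm_num
    nlinarith

section Asymptotics

variable {X : Type*} {𝓁 : Filter X} {z ω₁ ω₂ : X → ℂ} {v w : ℂ} {c : ℝ}

/-- The two leading terms of `lineInt p 1 1` as `ω₂ → 0` within a sector around the positive real
axis. -/
theorem tendsto_lineInt_sub {p : ℕ} {η : ℝ} (hz : Tendsto z 𝓁 (𝓝 v)) (hω₁ : Tendsto ω₁ 𝓁 (𝓝 w))
    (hω₂ : Tendsto ω₂ 𝓁 (𝓝 0)) (hne : ∀ᶠ x in 𝓁, ω₂ x ≠ 0) (hc : 0 < c)
    (hsec : ∀ᶠ x in 𝓁, c * ‖ω₂ x‖ ≤ (ω₂ x).re) (hadm : Adm p 0 η v w w)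
    (hadm' : ∀ᶠ x in 𝓁, Adm p 1 η (z x) (ω₁ x) (ω₂ x)) :
    Tendsto (fun x => lineInt p 1 1 η (z x) (ω₁ x) (ω₂ x)
      - ((ω₂ x)⁻¹ * lineInt p 0 2 η (z x) (ω₁ x) (ω₁ x)
        - 1 / 2 * lineInt p 0 1 η (z x) (ω₁ x) (ω₁ x))) 𝓁 (𝓝 0) := by
  have hη := hadm.η_pos
  have htri : Tendsto (fun x => (z x, ω₁ x, ω₁ x)) 𝓁 (𝓝 (v, w, w)) :=
    hz.prodMk_nhds (hω₁.prodMk_nhds hω₁)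
  obtain ⟨C, δ, hC, hδ, hb⟩ := Adm.exists_bound (x := (v, w, w)) hadm 0
  have hb := htri.eventually hb
  have hadm0 := htri.eventually (Adm.eventually (x := (v, w, w)) hadm)
  have hsmall : ∀ᶠ x in 𝓁, η * ‖ω₂ x‖ ≤ c / 8 := by
    have h1 : Tendsto (fun x => η * ‖ω₂ x‖) 𝓁 (𝓝 0) := by
      simpa using hω₂.norm.const_mul η
    exact (h1.eventually (gt_mem_nhds (by positivity : 0 < c / 8))).mono fun _ h => h.le
  set K := 2 * (1 - Real.exp (-(c / 4)))⁻¹ + 5 with hK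
  refine squeeze_zero_norm' (a := fun x => (K * ‖ω₂ x‖) * ∫ t : ℝ, C * Real.exp (-δ * |t|)) ?_ ?_
  · filter_upwards [hb, hadm0, hsmall, hne, hsec, hadm'] with x hb h0 hs hne hsec h1
    have i1 := h1.integrable 1
    have i2 := (h0.integrable 2).const_mul (ω₂ x)⁻¹
    have i3 := (h0.integrable 1).const_mul (1 / 2 : ℂ)
    have e : lineInt p 1 1 η (z x) (ω₁ x) (ω₂ x)
        - ((ω₂ x)⁻¹ * lineInt p 0 2 η (z x) (ω₁ x) (ω₁ x)
          - 1 / 2 * lineInt p 0 1 η (z x) (ω₁ x) (ω₁ x))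
        = ∫ t : ℝ, kernel p 0 0 (z x) (ω₁ x) (ω₁ x) (t + η * I)
          * (toddRem (ω₂ x * (t + η * I)) * ((t : ℂ) + η * I)⁻¹) := by
      simp only [lineInt]
      rw [← integral_const_mul, ← integral_const_mul, ← integral_sub i2 i3,
        ← integral_sub i1 (by exact i2.sub i3)]
      refine integral_congr_ae (ae_of_all _ fun t => ?_)
      simp only [kernel, toddRem, mul_inv, pow_zero, mul_one, pow_one, pow_two]
      ring
    rw [e, ← integral_const_mul]
    refine norm_integral_le_of_norm_le ((integrable_exp_neg_mul_abs hδ C).const_mul _)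
      (ae_of_all _ fun t => ?_)
    have hs0 : 0 < ‖(t : ℂ) + η * I‖ := norm_pos_iff.2 (line_ne_zero hη t)
    have hB := norm_toddRem_le hc hη hne hsec hs t
    rw [← hK, norm_mul (ω₂ x)] at hB
    rw [norm_mul, norm_mul, norm_inv, mul_comm (K * _)]
    refine mul_le_mul (hb t) ?_ (by positivity) (by positivity)
    rw [← div_eq_mul_inv, div_le_iff₀ hs0]
    linarith
  · simpa using (hω₂.norm.const_mul K).mul_const (∫ t : ℝ, C * Real.exp (-δ * |t|))

/-- A single height of the line serves for all small `ω₂` in the sector. -/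
theorem exists_height_eventually (hz : Tendsto z 𝓁 (𝓝 v)) (hω₁ : Tendsto ω₁ 𝓁 (𝓝 w))
    (hω₂ : Tendsto ω₂ 𝓁 (𝓝 0)) (hne : ∀ᶠ x in 𝓁, ω₂ x ≠ 0) (hc : 0 < c)
    (hsec : ∀ᶠ x in 𝓁, c * ‖ω₂ x‖ ≤ (ω₂ x).re) (hv : 0 < v.re) (hvw : v.re < w.re) :
    ∃ η : ℝ, Adm 1 0 η v w w ∧ (∀ᶠ x in 𝓁, IsHeight η (ω₁ x) (ω₂ x)) ∧
      (∀ᶠ x in 𝓁, InStrip (z x) (ω₁ x) (ω₂ x)) ∧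
      ∀ᶠ x in 𝓁, Adm 1 0 η (z x) (ω₁ x) (ω₁ x) := by
  have hw : 0 < w.re := hv.trans hvw
  have hw0 : 0 < ‖w‖ := norm_pos_iff.2 (by rintro rfl; simp at hw)
  obtain ⟨η, hη⟩ := exists_isHeight hw hw
  have hη0 := hη.pos
  have hadm : Adm 1 0 η v w w := ⟨hη.pos, hw, hw, hη.lt₁, hη.lt₂, hv, by simpa using hvw⟩
  have htri : Tendsto (fun x => (z x, ω₁ x, ω₁ x)) 𝓁 (𝓝 (v, w, w)) :=
    hz.prodMk_nhds (hω₁.prodMk_nhds hω₁)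
  have hadm' := htri.eventually (Adm.eventually (x := (v, w, w)) hadm)
  have hpos : ∀ᶠ x in 𝓁, 0 < (ω₂ x).re := by
    filter_upwards [hne, hsec] with x h1 h2
    exact (mul_pos hc (norm_pos_iff.2 h1)).trans_le h2
  refine ⟨η, hadm, ?_, ?_, hadm'⟩
  · have h1 : ∀ᶠ x in 𝓁, η < detour (ω₁ x) (ω₂ x) := by
      have ht : Tendsto (fun x => detour (ω₁ x) (ω₂ x)) 𝓁 (𝓝 (1 / (‖w‖ + ‖(0 : ℂ)‖))) :=
        tendsto_const_nhds.div (hω₁.norm.add hω₂.norm) (by simpa using hw0.ne')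
      refine ht.eventually (lt_mem_nhds (hη.lt_detour.trans ?_))
      rw [detour, norm_zero, add_zero]
      exact one_div_lt_one_div_of_lt hw0 (by linarith)
    have h2 : ∀ᶠ x in 𝓁, η * ‖ω₂ x‖ < 2 * Real.pi * c := by
      have ht : Tendsto (fun x => η * ‖ω₂ x‖) 𝓁 (𝓝 0) := by simpa using hω₂.norm.const_mul η
      have := Real.pi_pos
      exact ht.eventually (gt_mem_nhds (by positivity))
    filter_upwards [h1, h2, hadm', hsec, hne] with x h1 h2 h3 h4 h5
    refine ⟨hη.pos, h1, h3.lt₁, ?_⟩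
    have h6 : 0 < ‖ω₂ x‖ := norm_pos_iff.2 h5
    calc η * ‖ω₂ x‖ ^ 2 = η * ‖ω₂ x‖ * ‖ω₂ x‖ := by ring
      _ < 2 * Real.pi * c * ‖ω₂ x‖ := by gcongr
      _ = 2 * Real.pi * (c * ‖ω₂ x‖) := by ring
      _ ≤ 2 * Real.pi * (ω₂ x).re := by
        have := Real.pi_pos
        gcongr
  · filter_upwards [hpos, hadm'] with x h1 h2
    have := h2.z_lt
    simp at this
    exact ⟨h2.re₁, h1, h2.z_pos, by rw [add_re]; linarith⟩

/-- The logarithm of the leading asymptotics of `F` as `ω₂ → 0`. -/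
noncomputable def asympF (z ω₁ ω₂ : ℂ) : ℂ :=
  ω₁ / ω₂ / (2 * Real.pi * I) * Li 2 (exp (2 * Real.pi * I * z / ω₁))
    - 1 / 2 * Li 1 (exp (2 * Real.pi * I * z / ω₁))

/-- The logarithm of the leading asymptotics of `G` as `ω₂ → 0`. -/
noncomputable def asympG (z ω₁ ω₂ : ℂ) : ℂ :=
  2 * (ω₁ / ω₂) / (2 * Real.pi * I) ^ 2 * Li 3 (exp (2 * Real.pi * I * z / ω₁))
    - z / ω₁ * (ω₁ / ω₂) / (2 * Real.pi * I) * Li 2 (exp (2 * Real.pi * I * z / ω₁))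
    + 1 / 2 * (z / ω₁ * Li 1 (exp (2 * Real.pi * I * z / ω₁))
      - Li 2 (exp (2 * Real.pi * I * z / ω₁)) / (2 * Real.pi * I))

theorem eventually_im_div_pos (hz : Tendsto z 𝓁 (𝓝 v)) (hω₁ : Tendsto ω₁ 𝓁 (𝓝 w))
    (hw : w ≠ 0) (h : 0 < (v / w).im) : ∀ᶠ x in 𝓁, 0 < (z x / ω₁ x).im :=
  ((continuous_im.tendsto _).comp (hz.div hω₁ hw)).eventually (lt_mem_nhds h)

theorem tendsto_FInt (hz : Tendsto z 𝓁 (𝓝 v)) (hω₁ : Tendsto ω₁ 𝓁 (𝓝 w))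
    (hω₂ : Tendsto ω₂ 𝓁 (𝓝 0)) (hne : ∀ᶠ x in 𝓁, ω₂ x ≠ 0) (hc : 0 < c)
    (hsec : ∀ᶠ x in 𝓁, c * ‖ω₂ x‖ ≤ (ω₂ x).re) (hv : 0 < v.re) (hvw : v.re < w.re)
    (him : 0 < (v / w).im) :
    Tendsto (fun x => FInt (z x) (ω₁ x) (ω₂ x) * exp (-asympF (z x) (ω₁ x) (ω₂ x))) 𝓁 (𝓝 1) := by
  obtain ⟨η, h0, hH, hS, h1⟩ := exists_height_eventually hz hω₁ hω₂ hne hc hsec hv hvw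
  have hadm : ∀ᶠ x in 𝓁, Adm 1 1 η (z x) (ω₁ x) (ω₂ x) := by
    filter_upwards [hH, hS] with x a b using b.adm a
  have hw : w ≠ 0 := by rintro rfl; simp at hvw; linarith
  have main := (tendsto_lineInt_sub hz hω₁ hω₂ hne hc hsec h0 hadm).cexp
  rw [exp_zero] at main
  refine main.congr' ?_
  filter_upwards [hH, hS, h1, eventually_im_div_pos hz hω₁ hw him] with x a b h1 him
  have hω : ω₁ x ≠ 0 := by intro h; have := h1.re₁; simp [h] at this
  have hπ : (Real.pi : ℂ) ≠ 0 := by exact_mod_cast Real.pi_ne_zero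
  rw [b.FInt_eq a, ← exp_add, h1.lineInt_eq_Li 1 him, h1.lineInt_eq_Li 2 him, asympF]
  congr 1
  field_simp
  ring

theorem tendsto_GInt (hz : Tendsto z 𝓁 (𝓝 v)) (hω₁ : Tendsto ω₁ 𝓁 (𝓝 w))
    (hω₂ : Tendsto ω₂ 𝓁 (𝓝 0)) (hne : ∀ᶠ x in 𝓁, ω₂ x ≠ 0) (hc : 0 < c)
    (hsec : ∀ᶠ x in 𝓁, c * ‖ω₂ x‖ ≤ (ω₂ x).re) (hv : 0 < v.re) (hvw : v.re < w.re)
    (him : 0 < (v / w).im) :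
    Tendsto (fun x => GInt (z x) (ω₁ x) (ω₂ x) * exp (-asympG (z x) (ω₁ x) (ω₂ x))) 𝓁 (𝓝 1) := by
  obtain ⟨η, h0, hH, hS, h1⟩ := exists_height_eventually hz hω₁ hω₂ hne hc hsec hv hvw
  have hadm : ∀ᶠ x in 𝓁, Adm 2 1 η (z x + ω₁ x) (ω₁ x) (ω₂ x) := by
    filter_upwards [hH, hS] with x a b using (b.adm a).add₁
  have hw : w ≠ 0 := by rintro rfl; simp at hvw; linarith
  have main := (tendsto_lineInt_sub (hz.add hω₁) hω₁ hω₂ hne hc hsec h0.add₁ hadm).neg.cexp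
  rw [neg_zero, exp_zero] at main
  refine main.congr' ?_
  filter_upwards [hH, hS, h1, eventually_im_div_pos hz hω₁ hw him, hne] with x a b h1 him hne
  have hω : ω₁ x ≠ 0 := by intro h; have := h1.re₁; simp [h] at this
  have hπ : (Real.pi : ℂ) ≠ 0 := by exact_mod_cast Real.pi_ne_zero
  have e1 := eq_div_of_mul_eq hω ((mul_comm _ _).trans (h1.lineInt_two 1))
  have e2 := eq_div_of_mul_eq hω ((mul_comm _ _).trans (h1.lineInt_two 2))
  rw [b.GInt_eq a, ← exp_add, e1, e2, h1.lineInt_eq_Li 1 him, h1.lineInt_eq_Li (1 + 1) him,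
    h1.lineInt_eq_Li (2 + 1) him, asympG]
  congr 1
  norm_num
  field_simp
  ring

end Asymptotics

/-! ### The limit at infinity -/

theorem re_cpow_half_pos {ρ : ℂ} (h : ρ ∈ slitPlane) : 0 < (ρ ^ (1 / 2 : ℂ)).re := by
  have h0 : ρ ≠ 0 := slitPlane_ne_zero h
  have h1 : (log ρ * (1 / 2 : ℂ)).im = ρ.arg / 2 := by
    rw [show log ρ * (1 / 2 : ℂ) = ((1 / 2 : ℝ) : ℂ) * log ρ by push_cast; ring, im_ofReal_mul,
      log_im]
    ring
  have h2 := (mem_slitPlane_iff_arg.1 h).1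
  have h3 := neg_pi_lt_arg ρ
  have h4 := lt_of_le_of_ne (arg_le_pi ρ) h2
  rw [cpow_def_of_ne_zero h0, exp_re, h1]
  exact mul_pos (Real.exp_pos _) (Real.cos_pos_of_mem_Ioo ⟨by linarith, by linarith⟩)

theorem re_inv_pos {σ : ℂ} (h : 0 < σ.re) : 0 < (σ⁻¹).re := by
  rw [inv_re]
  exact div_pos h (normSq_pos.2 (by rintro rfl; simp at h))

theorem cpow_half_sq (ρ : ℂ) : (ρ ^ (1 / 2 : ℂ)) ^ 2 = ρ := by
  rw [← cpow_nat_mul]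
  norm_num

theorem cpow_half_ne_zero {ρ : ℂ} (h : ρ ∈ slitPlane) : ρ ^ (1 / 2 : ℂ) ≠ 0 := by
  intro h0
  have := re_cpow_half_pos h
  rw [h0] at this
  simp at this

theorem scale_mul {ω₁ ω₂ : ℂ} (h : ω₁ / ω₂ ∈ slitPlane) (z : ℂ) :
    scale ω₁ ω₂ * z = (ω₁ / ω₂) ^ (1 / 2 : ℂ) * (z / ω₁) ∧
    scale ω₁ ω₂ * ω₁ = (ω₁ / ω₂) ^ (1 / 2 : ℂ) ∧
    scale ω₁ ω₂ * ω₂ = ((ω₁ / ω₂) ^ (1 / 2 : ℂ))⁻¹ := by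
  have h0 := slitPlane_ne_zero h
  have h1 : ω₁ ≠ 0 := by rintro rfl; simp at h0
  have h2 : ω₂ ≠ 0 := by rintro rfl; simp at h0
  refine ⟨by rw [scale]; ring, by rw [scale, div_mul_cancel₀ _ h1], ?_⟩
  refine eq_inv_of_mul_eq_one_left ?_
  rw [scale]
  have := cpow_half_sq (ω₁ / ω₂)
  calc _ = ((ω₁ / ω₂) ^ (1 / 2 : ℂ)) ^ 2 * ω₂ / ω₁ := by ring
    _ = 1 := by rw [this]; field_simp

/-- Both branches in the definition of `F` are the continuation at the periods normalised to have
product `1`. -/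
theorem F_eq_FHalf {ω₁ ω₂ : ℂ} (h : ω₁ / ω₂ ∈ slitPlane) (z : ℂ) :
    F z ω₁ ω₂ = FHalf ((ω₁ / ω₂) ^ (1 / 2 : ℂ) * (z / ω₁)) ((ω₁ / ω₂) ^ (1 / 2 : ℂ))
      ((ω₁ / ω₂) ^ (1 / 2 : ℂ))⁻¹ := by
  obtain ⟨e1, e2, e3⟩ := scale_mul h z
  have h1 := re_cpow_half_pos h
  rw [← e1, ← e3, ← e2, F]
  split_ifs with hre
  · exact (FHalf_smul hre.1 hre.2 (by rwa [e2]) (by rw [e3]; exact re_inv_pos h1)).symm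
  · rfl

theorem G_eq_GHalf {ω₁ ω₂ : ℂ} (h : ω₁ / ω₂ ∈ slitPlane) (z : ℂ) :
    G z ω₁ ω₂ = GHalf ((ω₁ / ω₂) ^ (1 / 2 : ℂ) * (z / ω₁)) ((ω₁ / ω₂) ^ (1 / 2 : ℂ))
      ((ω₁ / ω₂) ^ (1 / 2 : ℂ))⁻¹ := by
  obtain ⟨e1, e2, e3⟩ := scale_mul h z
  have h1 := re_cpow_half_pos h
  rw [← e1, ← e3, ← e2, G]
  split_ifs with hre
  · exact (GHalf_smul hre.1 hre.2 (by rwa [e2]) (by rw [e3]; exact re_inv_pos h1)).symm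
  · rfl

section Infinity

variable {v w ϑ φ : ℂ}

theorem tendsto_params_cobounded (h : φ / (2 * Real.pi * I) ∈ slitPlane) (v w ϑ : ℂ) :
    Tendsto (fun ħ : ℂ => (w - ħ * φ) / (-2 * Real.pi * I * ħ)) (Bornology.cobounded ℂ)
      (𝓝 (φ / (2 * Real.pi * I))) ∧
    Tendsto (fun ħ : ℂ => (v - ħ * ϑ) / (w - ħ * φ)) (Bornology.cobounded ℂ) (𝓝 (ϑ / φ)) := by
  have hφ : φ ≠ 0 := by rintro rfl; simp at h
  have hπ : (-2 * Real.pi * I : ℂ) ≠ 0 := by simp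
  have h0 := tendsto_inv₀_cobounded (α := ℂ)
  have hlin (a b : ℂ) : Tendsto (fun ħ : ℂ => a * ħ⁻¹ - b) (Bornology.cobounded ℂ) (𝓝 (-b)) := by
    simpa using (h0.const_mul a).sub_const b
  constructor
  · have := (hlin w φ).div_const (-2 * Real.pi * I)
    rw [show -φ / (-2 * Real.pi * I) = φ / (2 * Real.pi * I) by
      rw [neg_mul, neg_mul, neg_div_neg_eq]] at this
    refine this.congr' ?_
    filter_upwards [Bornology.eventually_ne_cobounded (0 : ℂ)] with ħ hħ
    rw [div_eq_div_iff hπ (mul_ne_zero hπ hħ)]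
    field_simp
  · have := (hlin v ϑ).div (hlin w φ) (neg_ne_zero.2 hφ)
    rw [neg_div_neg_eq] at this
    refine this.congr' ?_
    filter_upwards [Bornology.eventually_ne_cobounded (0 : ℂ)] with ħ hħ
    have e (a b : ℂ) : a * ħ⁻¹ - b = (a - ħ * b) / ħ := by field_simp
    rw [Pi.div_apply, e, e, div_div_div_cancel_right₀ hħ]

/-- In the limit the periods, rescaled to `σ` and `σ⁻¹` with `σ² = φ / 2πi`, have positive real part,
and the genericity of `(ϑ, φ)` keeps the argument off their lattice. -/
theorem IsGeneric.limit_params (h : IsGeneric ϑ φ) :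
    ∀ a b : ℤ, (φ / (2 * Real.pi * I)) ^ (1 / 2 : ℂ) * (ϑ / φ)
      ≠ a * (φ / (2 * Real.pi * I)) ^ (1 / 2 : ℂ)
        + b * ((φ / (2 * Real.pi * I)) ^ (1 / 2 : ℂ))⁻¹ := by
  intro a b h1
  have hφ : φ ≠ 0 := by rintro rfl; simpa using h.1
  have hsq := cpow_half_sq (φ / (2 * Real.pi * I))
  have hσ := cpow_half_ne_zero h.1
  set σ := (φ / (2 * Real.pi * I)) ^ (1 / 2 : ℂ)
  refine h.2 a b ?_
  have hπ : (2 * Real.pi * I : ℂ) ≠ 0 := by simp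
  have h2 : σ ^ 2 * ϑ = (a * σ ^ 2 + b) * φ := by
    field_simp at h1
    linear_combination h1
  rw [hsq] at h2
  have : φ * ϑ = φ * (a * φ + b * (2 * Real.pi * I)) := by
    field_simp at h2
    linear_combination φ * h2
  exact mul_left_cancel₀ hφ this

theorem tendsto_scaled_params (h : IsGeneric ϑ φ) (v w : ℂ) :
    Tendsto (fun ħ : ℂ =>
      (((w - ħ * φ) / (-2 * Real.pi * I * ħ)) ^ (1 / 2 : ℂ) * ((v - ħ * ϑ) / (w - ħ * φ)),
        ((w - ħ * φ) / (-2 * Real.pi * I * ħ)) ^ (1 / 2 : ℂ),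
        (((w - ħ * φ) / (-2 * Real.pi * I * ħ)) ^ (1 / 2 : ℂ))⁻¹)) (Bornology.cobounded ℂ)
      (𝓝 ((φ / (2 * Real.pi * I)) ^ (1 / 2 : ℂ) * (ϑ / φ),
        (φ / (2 * Real.pi * I)) ^ (1 / 2 : ℂ), ((φ / (2 * Real.pi * I)) ^ (1 / 2 : ℂ))⁻¹)) := by
  obtain ⟨h1, h2⟩ := tendsto_params_cobounded h.1 v w ϑ
  have h3 := (continuousAt_cpow_const (b := 1 / 2) h.1).tendsto.comp h1
  have hσ := cpow_half_ne_zero h.1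
  exact (h3.mul h2).prodMk_nhds (h3.prodMk_nhds (h3.inv₀ hσ))

theorem exists_bound_of_tendsto_cobounded {f : ℂ → ℂ} {L : ℂ}
    (h : Tendsto f (Bornology.cobounded ℂ) (𝓝 L)) :
    ∃ R C : ℝ, ∀ ħ : ℂ, 0 < ħ.im → R < ‖ħ‖ → ‖f ħ‖ ≤ C := by
  have h1 := h.norm.eventually (gt_mem_nhds (lt_add_one ‖L‖))
  rw [hasBasis_cobounded_norm.eventually_iff] at h1
  obtain ⟨R, -, hR⟩ := h1
  exact ⟨R, ‖L‖ + 1, fun ħ _ hħ => (hR hħ.le).le⟩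

theorem tendsto_div_cobounded (a b c : ℂ) :
    Tendsto (fun ħ : ℂ => c / ħ * ((a - ħ * b))) (Bornology.cobounded ℂ) (𝓝 (-(c * b))) := by
  have := (((tendsto_inv₀_cobounded (α := ℂ)).const_mul (c * a)).sub_const (c * b))
  rw [mul_zero, zero_sub] at this
  refine this.congr' ?_
  filter_upwards [Bornology.eventually_ne_cobounded (0 : ℂ)] with ħ hħ
  field_simp

theorem exists_tendsto_QF (v w ϑ φ : ℂ) :
    ∃ L, Tendsto (fun ħ => QF v w ϑ φ ħ) (Bornology.cobounded ℂ) (𝓝 L) := by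
  refine ⟨_, Tendsto.congr (fun ħ => ?_) (((tendsto_div_cobounded w φ
    (1 / (2 * Real.pi * I) ^ 2)).mul_const (Li 2 (exp (2 * Real.pi * I * v / w)))).add_const
    (((v * φ - w * ϑ) / (2 * Real.pi * I * w) + 1 / 2) * Li 1 (exp (2 * Real.pi * I * v / w))))⟩
  rw [QF]
  ring

theorem exists_tendsto_QG (v w ϑ φ : ℂ) :
    ∃ L, Tendsto (fun ħ => QG v w ϑ φ ħ) (Bornology.cobounded ℂ) (𝓝 L) := by
  refine ⟨_, Tendsto.congr (fun ħ => ?_) (((((tendsto_div_cobounded w φ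
    (2 / (2 * Real.pi * I) ^ 3)).mul_const (Li 3 (exp (2 * Real.pi * I * v / w)))).sub
    ((tendsto_div_cobounded v ϑ
    (1 / (2 * Real.pi * I) ^ 2)).mul_const (Li 2 (exp (2 * Real.pi * I * v / w))))).add_const
    (1 / (Real.pi * I) * ((v * φ - w * ϑ) / (2 * Real.pi * I * w) + 1 / 4)
        * Li 2 (exp (2 * Real.pi * I * v / w)))).sub_const
    (v / w * ((v * φ - w * ϑ) / (2 * Real.pi * I * w) + 1 / 2)
      * Li 1 (exp (2 * Real.pi * I * v / w))))⟩
  rw [QG]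
  ring

theorem eventually_slitPlane (h : IsGeneric ϑ φ) (w : ℂ) :
    ∀ᶠ ħ : ℂ in Bornology.cobounded ℂ, (w - ħ * φ) / (-2 * Real.pi * I * ħ) ∈ slitPlane :=
  (tendsto_params_cobounded h.1 0 w 0).1.eventually (isOpen_slitPlane.mem_nhds h.1)

theorem exists_tendsto_Fstar (h : IsGeneric ϑ φ) (v w : ℂ) :
    ∃ L, Tendsto (fun ħ => Fstar v w ϑ φ ħ) (Bornology.cobounded ℂ) (𝓝 L) := by
  obtain ⟨L, hL⟩ := exists_tendsto_QF v w ϑ φ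
  have hσ := re_cpow_half_pos h.1
  have hF := (continuousAt_FHalf (x := ((φ / (2 * Real.pi * I)) ^ (1 / 2 : ℂ) * (ϑ / φ),
    (φ / (2 * Real.pi * I)) ^ (1 / 2 : ℂ), ((φ / (2 * Real.pi * I)) ^ (1 / 2 : ℂ))⁻¹)) hσ
    (re_inv_pos hσ) h.limit_params).tendsto.comp (tendsto_scaled_params h v w)
  refine ⟨_, (hF.mul hL.cexp).congr' ?_⟩
  filter_upwards [eventually_slitPlane h w] with ħ hħ
  rw [Fstar, F_eq_FHalf hħ]
  rfl

theorem exists_tendsto_Gstar (h : IsGeneric ϑ φ) (v w : ℂ) :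
    ∃ L, Tendsto (fun ħ => Gstar v w ϑ φ ħ) (Bornology.cobounded ℂ) (𝓝 L) := by
  obtain ⟨L, hL⟩ := exists_tendsto_QG v w ϑ φ
  have hσ := re_cpow_half_pos h.1
  have hG := (continuousAt_GHalf (x := ((φ / (2 * Real.pi * I)) ^ (1 / 2 : ℂ) * (ϑ / φ),
    (φ / (2 * Real.pi * I)) ^ (1 / 2 : ℂ), ((φ / (2 * Real.pi * I)) ^ (1 / 2 : ℂ))⁻¹)) hσ
    (re_inv_pos hσ) h.limit_params).tendsto.comp (tendsto_scaled_params h v w)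
  refine ⟨_, (hG.mul hL.cexp).congr' ?_⟩
  filter_upwards [eventually_slitPlane h w] with ħ hħ
  rw [Gstar, G_eq_GHalf hħ]
  rfl

end Infinity

/-! ### The limit at zero -/

section Rotation

variable {X : Type*} {𝓁 : Filter X} {z ω₁ ω₂ : X → ℂ} {v w : ℂ} {κ : ℝ}

theorem re_one_add_mul (κ : ℝ) (ω : ℂ) : ((1 + κ * I) * ω).re = ω.re - κ * ω.im := by
  simp

/-- Rotating a half of the right half-plane away from the imaginary axis puts it into a sector. -/
theorem sector_of_rotation {ω : ℂ} (hω : 0 < ω.re) (h : κ * ω.im ≤ 0) :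
    min 1 |κ| / ‖(1 + κ * I : ℂ)‖ * ‖(1 + κ * I) * ω‖ ≤ ((1 + κ * I) * ω).re := by
  have h1 : 0 < ‖(1 + κ * I : ℂ)‖ := by
    refine norm_pos_iff.2 fun h0 => ?_
    have := congrArg re h0
    simp at this
  rw [norm_mul, ← mul_assoc, div_mul_cancel₀ _ h1.ne', re_one_add_mul]
  have h2 := norm_le_abs_re_add_abs_im ω
  have h3 : -(κ * ω.im) = |κ| * |ω.im| := by rw [← abs_mul, abs_of_nonpos h]
  have h4 : 0 ≤ min 1 |κ| := le_min zero_le_one (abs_nonneg _)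
  rw [abs_of_pos hω] at h2
  calc min 1 |κ| * ‖ω‖ ≤ min 1 |κ| * (ω.re + |ω.im|) := by gcongr
    _ = min 1 |κ| * ω.re + min 1 |κ| * |ω.im| := by ring
    _ ≤ 1 * ω.re + |κ| * |ω.im| := by
      gcongr
      · exact min_le_left _ _
      · exact min_le_right _ _
    _ = _ := by rw [← h3]; ring

theorem asympF_smul {l : ℂ} (hl : l ≠ 0) (z ω₁ ω₂ : ℂ) :
    asympF (l * z) (l * ω₁) (l * ω₂) = asympF z ω₁ ω₂ := by
  have h : 2 * Real.pi * I * (l * z) / (l * ω₁) = 2 * Real.pi * I * z / ω₁ := by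
    rw [mul_left_comm, mul_div_mul_left _ _ hl]
  rw [asympF, asympF, h, mul_div_mul_left _ _ hl]

theorem asympG_smul {l : ℂ} (hl : l ≠ 0) (z ω₁ ω₂ : ℂ) :
    asympG (l * z) (l * ω₁) (l * ω₂) = asympG z ω₁ ω₂ := by
  have h : 2 * Real.pi * I * (l * z) / (l * ω₁) = 2 * Real.pi * I * z / ω₁ := by
    rw [mul_left_comm, mul_div_mul_left _ _ hl]
  rw [asympG, asympG, h, mul_div_mul_left _ _ hl, mul_div_mul_left _ _ hl]

/-- The asymptotics in the part of the right half-plane for `ω₂` which rotates into a sector. -/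
theorem tendsto_F_and_G (hz : Tendsto z 𝓁 (𝓝 v)) (hω₁ : Tendsto ω₁ 𝓁 (𝓝 w))
    (hω₂ : Tendsto ω₂ 𝓁 (𝓝 0)) (hpos : ∀ᶠ x in 𝓁, 0 < (ω₂ x).re)
    (hv : 0 < v.re) (hvw : v.re < w.re) (him : 0 < (v / w).im) (hκ : κ ≠ 0)
    (hv' : 0 < ((1 + κ * I) * v).re) (hvw' : ((1 + κ * I) * v).re < ((1 + κ * I) * w).re)
    (hside : ∀ᶠ x in 𝓁, κ * (ω₂ x).im ≤ 0) :
    Tendsto (fun x => F (z x) (ω₁ x) (ω₂ x) * exp (-asympF (z x) (ω₁ x) (ω₂ x))) 𝓁 (𝓝 1) ∧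
    Tendsto (fun x => G (z x) (ω₁ x) (ω₂ x) * exp (-asympG (z x) (ω₁ x) (ω₂ x))) 𝓁 (𝓝 1) := by
  set l : ℂ := 1 + κ * I
  have hl : l ≠ 0 := by rintro h; rw [h] at hv'; simp at hv'
  have hne : ∀ᶠ x in 𝓁, l * ω₂ x ≠ 0 := by
    filter_upwards [hpos] with x hx
    exact mul_ne_zero hl (by intro h; simp [h] at hx)
  have hc : 0 < min 1 |κ| / ‖l‖ :=
    div_pos (lt_min one_pos (abs_pos.2 hκ)) (norm_pos_iff.2 hl)
  have hsec : ∀ᶠ x in 𝓁, min 1 |κ| / ‖l‖ * ‖l * ω₂ x‖ ≤ (l * ω₂ x).re := by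
    filter_upwards [hpos, hside] with x h1 h2 using sector_of_rotation h1 h2
  have hω₂' : Tendsto (fun x => l * ω₂ x) 𝓁 (𝓝 0) := by simpa using hω₂.const_mul l
  have him' : 0 < (l * v / (l * w)).im := by rwa [mul_div_mul_left _ _ hl]
  obtain ⟨-, -, -, hS, -⟩ := exists_height_eventually (hz.const_mul l) (hω₁.const_mul l) hω₂' hne
    hc hsec hv' hvw'
  have hre₁ : ∀ᶠ x in 𝓁, 0 < (ω₁ x).re :=
    ((continuous_re.tendsto _).comp hω₁).eventually (lt_mem_nhds (hv.trans hvw))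
  constructor
  · refine (tendsto_FInt (hz.const_mul l) (hω₁.const_mul l) hω₂' hne hc hsec hv' hvw' him').congr' ?_
    filter_upwards [hS, hre₁, hpos] with x hS h1 h2
    rw [asympF_smul hl, ← hS.FHalf_eq, FHalf_smul h1 h2 hS.re₁ hS.re₂, F, if_pos ⟨h1, h2⟩]
  · refine (tendsto_GInt (hz.const_mul l) (hω₁.const_mul l) hω₂' hne hc hsec hv' hvw' him').congr' ?_
    filter_upwards [hS, hre₁, hpos] with x hS h1 h2
    rw [asympG_smul hl, ← hS.GHalf_eq, GHalf_smul h1 h2 hS.re₁ hS.re₂, G, if_pos ⟨h1, h2⟩]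

/-- Both quarters of the half-plane `Im ħ > 0` can be treated after a small rotation. -/
theorem tendsto_F_and_G_upper (hv : 0 < v.re) (hvw : v.re < w.re) (him : 0 < (v / w).im)
    (ϑ φ : ℂ) :
    Tendsto (fun ħ : ℂ => F (v - ħ * ϑ) (w - ħ * φ) (-2 * Real.pi * I * ħ)
      * exp (-asympF (v - ħ * ϑ) (w - ħ * φ) (-2 * Real.pi * I * ħ)))
      (𝓝[{ħ : ℂ | 0 < ħ.im}] 0) (𝓝 1) ∧
    Tendsto (fun ħ : ℂ => G (v - ħ * ϑ) (w - ħ * φ) (-2 * Real.pi * I * ħ)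
      * exp (-asympG (v - ħ * ϑ) (w - ħ * φ) (-2 * Real.pi * I * ħ)))
      (𝓝[{ħ : ℂ | 0 < ħ.im}] 0) (𝓝 1) := by
  obtain ⟨α, hα, hα1, hα2, hα3, hα4⟩ : ∃ α : ℝ, 0 < α ∧ 0 < v.re - α * v.im ∧
      0 < v.re - -α * v.im ∧ 0 < (w - v).re - α * (w - v).im ∧
      0 < (w - v).re - -α * (w - v).im := by
    have hwv : 0 < (w - v).re := by rw [sub_re]; linarith
    have e (a b : ℝ) (ha : 0 < a) : ∀ᶠ α : ℝ in 𝓝[>] 0, 0 < a - α * b :=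
      nhdsWithin_le_nhds (continuousAt_const.eventually_lt (by fun_prop) (by simpa))
    have e' (a b : ℝ) (ha : 0 < a) : ∀ᶠ α : ℝ in 𝓝[>] 0, 0 < a - -α * b :=
      nhdsWithin_le_nhds (continuousAt_const.eventually_lt (by fun_prop) (by simpa))
    obtain ⟨α, ⟨⟨⟨⟨h1, h2⟩, h3⟩, h4⟩, h5⟩⟩ := (((((e _ v.im hv).and (e' _ v.im hv)).and
      (e _ (w - v).im hwv)).and (e' _ (w - v).im hwv)).and self_mem_nhdsWithin).exists
    exact ⟨α, h5, h1, h2, h3, h4⟩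
  have key (κ : ℝ) (hκ : κ ≠ 0) (h1 : 0 < v.re - κ * v.im)
      (h2 : 0 < (w - v).re - κ * (w - v).im) :=
    tendsto_F_and_G (𝓁 := 𝓝[{ħ : ℂ | 0 < ħ.im ∧ 0 ≤ κ * ħ.re}] 0)
      (z := fun ħ => v - ħ * ϑ) (ω₁ := fun ħ => w - ħ * φ) (ω₂ := fun ħ => -2 * Real.pi * I * ħ)
      (v := v) (w := w) (κ := κ)
      (tendsto_nhdsWithin_of_tendsto_nhds (by
        have : Continuous fun ħ : ℂ => v - ħ * ϑ := by fun_prop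
        simpa using this.tendsto 0))
      (tendsto_nhdsWithin_of_tendsto_nhds (by
        have : Continuous fun ħ : ℂ => w - ħ * φ := by fun_prop
        simpa using this.tendsto 0))
      (tendsto_nhdsWithin_of_tendsto_nhds (by
        have : Continuous fun ħ : ℂ => -2 * Real.pi * I * ħ := by fun_prop
        simpa using this.tendsto 0))
      (by
        filter_upwards [self_mem_nhdsWithin] with ħ hħ
        have := Real.pi_pos
        have h3 : 0 < ħ.im := hħ.1
        simp
        positivity)
      hv hvw him hκ (by rwa [re_one_add_mul])
      (by rw [re_one_add_mul, re_one_add_mul]; simp only [sub_re, sub_im] at h2; linarith)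
      (by
        filter_upwards [self_mem_nhdsWithin] with ħ hħ
        have := Real.pi_pos
        have h3 : 0 ≤ κ * ħ.re := hħ.2
        have e : (-2 * Real.pi * I * ħ).im = -(2 * Real.pi) * ħ.re := by simp
        rw [e]
        nlinarith)
  have hset : {ħ : ℂ | 0 < ħ.im} = {ħ : ℂ | 0 < ħ.im ∧ 0 ≤ α * ħ.re}
      ∪ {ħ : ℂ | 0 < ħ.im ∧ 0 ≤ -α * ħ.re} := by
    ext ħ
    simp only [Set.mem_union, Set.mem_ofPred_eq, ← and_or_left, neg_mul, Left.nonneg_neg_iff]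
    exact ⟨fun h => ⟨h, le_total _ _⟩, fun h => h.1⟩
  have k1 := key α hα.ne' hα1 hα3
  have k2 := key (-α) (neg_ne_zero.2 hα.ne') hα2 hα4
  rw [hset, nhdsWithin_union]
  exact ⟨k1.1.sup k2.1, k1.2.sup k2.2⟩

end Rotation

section Expansion

variable {v w : ℂ}

theorem hasDerivAt_arg (hw : w ≠ 0) (v ϑ φ : ℂ) :
    HasDerivAt (fun ħ : ℂ => 2 * Real.pi * I * (v - ħ * ϑ) / (w - ħ * φ))
      (2 * Real.pi * I * (v * φ - w * ϑ) / w ^ 2) 0 := by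
  have h1 : HasDerivAt (fun ħ : ℂ => 2 * Real.pi * I * (v - ħ * ϑ)) (2 * Real.pi * I * (-ϑ)) 0 := by
    simpa using (((hasDerivAt_id (0 : ℂ)).mul_const ϑ).const_sub v).const_mul (2 * Real.pi * I)
  have h2 : HasDerivAt (fun ħ : ℂ => w - ħ * φ) (-φ) 0 := by
    simpa using ((hasDerivAt_id (0 : ℂ)).mul_const φ).const_sub w
  refine (h1.fun_div h2 (by simpa)).congr_deriv ?_
  simp only [zero_mul, sub_zero]
  congr 1
  ring

/-- The first two terms of the expansion of `Li_{k+1}` in `ħ`. -/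
theorem tendsto_slope_Li (hw : w ≠ 0) (him : 0 < (v / w).im) (ϑ φ : ℂ) (k : ℕ) :
    Tendsto (fun ħ : ℂ => ħ⁻¹ * (Li (k + 1) (exp (2 * Real.pi * I * (v - ħ * ϑ) / (w - ħ * φ)))
      - Li (k + 1) (exp (2 * Real.pi * I * v / w)))) (𝓝[≠] 0)
      (𝓝 (2 * Real.pi * I * (v * φ - w * ϑ) / w ^ 2 * Li k (exp (2 * Real.pi * I * v / w)))) := by
  have := (hasDerivAt_Li_exp (hasDerivAt_arg hw v ϑ φ)
    (by simpa using norm_exp_two_pi_lt_one him) k).tendsto_slope_zero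
  simpa using this

theorem tendsto_Li (hw : w ≠ 0) (him : 0 < (v / w).im) (ϑ φ : ℂ) (k : ℕ) :
    Tendsto (fun ħ : ℂ => Li (k + 1) (exp (2 * Real.pi * I * (v - ħ * ϑ) / (w - ħ * φ))))
      (𝓝[≠] 0) (𝓝 (Li (k + 1) (exp (2 * Real.pi * I * v / w)))) := by
  have := (hasDerivAt_Li_exp (hasDerivAt_arg hw v ϑ φ)
    (by simpa using norm_exp_two_pi_lt_one him) k).continuousAt.tendsto
  simp only [zero_mul, sub_zero] at this
  exact this.mono_left nhdsWithin_le_nhds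

theorem tendsto_sub_mul (a b : ℂ) : Tendsto (fun ħ : ℂ => a - ħ * b) (𝓝[≠] 0) (𝓝 a) := by
  have : Continuous fun ħ : ℂ => a - ħ * b := by fun_prop
  exact tendsto_nhdsWithin_of_tendsto_nhds (by simpa using this.tendsto 0)

/-- The exponent `Q_F` cancels the leading asymptotics of `F`: the term with `Li₁` in `Q_F` is the
first-order change of `Li₂` under the perturbation of `(v, w)` by `-ħ (ϑ, φ)`. -/
theorem tendsto_QF_add_asympF (hw : w ≠ 0) (him : 0 < (v / w).im) (ϑ φ : ℂ) :
    Tendsto (fun ħ : ℂ => QF v w ϑ φ ħ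
      + asympF (v - ħ * ϑ) (w - ħ * φ) (-2 * Real.pi * I * ħ)) (𝓝[≠] 0) (𝓝 0) := by
  have hπ : (Real.pi : ℂ) ≠ 0 := by exact_mod_cast Real.pi_ne_zero
  have h1 := (((tendsto_sub_mul w φ).div_const ((2 * Real.pi * I) ^ 2)).mul
    (tendsto_slope_Li hw him ϑ φ 1)).neg
  have h2 := ((tendsto_Li hw him ϑ φ 0).const_mul (1 / 2)).const_sub
    (((v * φ - w * ϑ) / (2 * Real.pi * I * w) + 1 / 2) * Li 1 (exp (2 * Real.pi * I * v / w)))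
  have h3 := h1.add h2
  have e : -(w / (2 * Real.pi * I) ^ 2 * (2 * Real.pi * I * (v * φ - w * ϑ) / w ^ 2
      * Li 1 (exp (2 * Real.pi * I * v / w))))
      + (((v * φ - w * ϑ) / (2 * Real.pi * I * w) + 1 / 2) * Li 1 (exp (2 * Real.pi * I * v / w))
        - 1 / 2 * Li (0 + 1) (exp (2 * Real.pi * I * v / w))) = 0 := by
    rw [zero_add]
    field_simp
    ring
  rw [e] at h3
  refine h3.congr' ?_
  filter_upwards [self_mem_nhdsWithin] with ħ hħ
  have hħ : ħ ≠ 0 := hħ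
  simp only [QF, asympF, zero_add, one_add_one_eq_two]
  field_simp
  ring

theorem tendsto_QG_add_asympG (hw : w ≠ 0) (him : 0 < (v / w).im) (ϑ φ : ℂ) :
    Tendsto (fun ħ : ℂ => QG v w ϑ φ ħ
      + asympG (v - ħ * ϑ) (w - ħ * φ) (-2 * Real.pi * I * ħ)) (𝓝[≠] 0) (𝓝 0) := by
  have hπ : (Real.pi : ℂ) ≠ 0 := by exact_mod_cast Real.pi_ne_zero
  have a1 := (((tendsto_sub_mul w φ).const_mul 2).div_const ((2 * Real.pi * I) ^ 3)).mul
    (tendsto_slope_Li hw him ϑ φ 2)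
  have a2 := ((tendsto_sub_mul v ϑ).div_const ((2 * Real.pi * I) ^ 2)).mul
    (tendsto_slope_Li hw him ϑ φ 1)
  have a3 := (((tendsto_sub_mul v ϑ).div (tendsto_sub_mul w φ) hw).mul
    (tendsto_Li hw him ϑ φ 0)).sub ((tendsto_Li hw him ϑ φ 1).div_const (2 * Real.pi * I))
  have h3 := ((a2.sub a1).add (a3.const_mul (1 / 2))).add_const
    (1 / (Real.pi * I) * ((v * φ - w * ϑ) / (2 * Real.pi * I * w) + 1 / 4)
        * Li 2 (exp (2 * Real.pi * I * v / w))
    - v / w * ((v * φ - w * ϑ) / (2 * Real.pi * I * w) + 1 / 2)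
        * Li 1 (exp (2 * Real.pi * I * v / w)))
  refine (h3.congr' ?_).mono_right (le_of_eq ?_)
  · filter_upwards [self_mem_nhdsWithin,
      (tendsto_sub_mul w φ).eventually (isOpen_ne.mem_nhds hw)] with ħ hħ hne
    have hħ : ħ ≠ 0 := hħ
    simp only [QG, asympG, zero_add, one_add_one_eq_two, Pi.div_apply]
    norm_num
    field_simp
    ring
  · congr 1
    simp only [zero_add, one_add_one_eq_two]
    field_simp
    ring

end Expansion

end Conifold

theorem lemma9 (v w : ℂ) (hM : (v, w) ∈ Conifold.Mplus) (hv : 0 < v.re) (hvw : v.re < w.re)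
    (ϑ φ : ℂ) :
    (Tendsto (fun ħ : ℂ => Conifold.Fstar v w ϑ φ ħ) (𝓝[{ħ : ℂ | 0 < ħ.im}] 0) (𝓝 1) ∧
      Tendsto (fun ħ : ℂ => Conifold.Gstar v w ϑ φ ħ) (𝓝[{ħ : ℂ | 0 < ħ.im}] 0) (𝓝 1)) ∧
    (Conifold.IsGeneric ϑ φ →
      (∃ R C : ℝ, ∀ ħ : ℂ, 0 < ħ.im → R < ‖ħ‖ → ‖Conifold.Fstar v w ϑ φ ħ‖ ≤ C) ∧
      (∃ R C : ℝ, ∀ ħ : ℂ, 0 < ħ.im → R < ‖ħ‖ → ‖Conifold.Gstar v w ϑ φ ħ‖ ≤ C)) := by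
  obtain ⟨hw, him⟩ := hM
  have hle : 𝓝[{ħ : ℂ | 0 < ħ.im}] 0 ≤ 𝓝[≠] (0 : ℂ) :=
    nhdsWithin_mono _ fun ħ (hħ : 0 < ħ.im) h0 => by
      have h0 : ħ = 0 := h0
      simp [h0] at hħ
  obtain ⟨hF, hG⟩ := Conifold.tendsto_F_and_G_upper hv hvw him ϑ φ
  refine ⟨⟨?_, ?_⟩, fun h => ⟨?_, ?_⟩⟩
  · have hQ := ((Conifold.tendsto_QF_add_asympF hw him ϑ φ).mono_left hle).cexp
    have := hF.mul hQ
    rw [exp_zero, mul_one] at this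
    refine this.congr fun ħ => ?_
    rw [Conifold.Fstar, mul_assoc, ← exp_add, neg_add_eq_sub, add_sub_cancel_right]
  · have hQ := ((Conifold.tendsto_QG_add_asympG hw him ϑ φ).mono_left hle).cexp
    have := hG.mul hQ
    rw [exp_zero, mul_one] at this
    refine this.congr fun ħ => ?_
    rw [Conifold.Gstar, mul_assoc, ← exp_add, neg_add_eq_sub, add_sub_cancel_right]
  · obtain ⟨L, hL⟩ := Conifold.exists_tendsto_Fstar h v w
    exact Conifold.exists_bound_of_tendsto_cobounded hL
  · obtain ⟨L, hL⟩ := Conifold.exists_tendsto_Gstar h v w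
    exact Conifold.exists_bound_of_tendsto_cobounded hL
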